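/- For a graph with nonnegative rational edge weights and a set $S$ of vertices, let $\delta(S)$ be the total weight of the edges with exactly one end in $S$. In Min-Max-Multiway-Cut with $k$ terminals the input is an undirected graph with nonnegative rational edge weights and $k$ distinct terminal vertices; a feasible solution is a partition of the vertex set into parts $S_1,\dots,S_k$ each of which contains exactly one terminal, and the objective, to be minimized, is $\max_i\delta(S_i)$. A $\rho$-approximation algorithm is a deterministic polynomial-time algorithm that on every instance outputs a feasible solution of value at most $\rho$ times the value of every feasible solution. In Min-Sum $k$-Partitioning the input is an undirected graph with nonnegative rational edge weights whose number $n$ of vertices is a multiple of $k$. An $(\alpha,\beta)$ bicriteria approximation algorithm for it is a deterministic polynomial-time algorithm that on every instance outputs a partition of the vertex set into $k$ (possibly empty) parts, each of size at most $\beta n/k$, such that the total weight of the edges between different parts is at most $\alpha$ times the least possible such weight among all partitions into $k$ parts of equal size. The number $k$ of parts is a constant of the problem, not part of the input; polynomial time refers to the bit length of the input, with weights written in binary as fractions, and the polynomial may depend on $k$. Theorem. Let $\varepsilon>0$ be a constant, and suppose that for every integer $k\ge 2$ there is a $k^{1-\varepsilon}$-approximation algorithm for Min-Max-Multiway-Cut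 with $k$ terminals. Then there is a real number $\gamma\le 3^{2/\varepsilon}$, which does not depend on $k$, such that for every integer $k\ge 2$ there is a $(k^2,\gamma)$ bicriteria approximation algorithm for Min-Sum $k$-Partitioning. -/

import Mathlib

namespace MinMaxCut

/-! ## Model of computation

Programs of a small deterministic language with pairs, natural numbers and loops, run at
logarithmic cost: every elementary operation is charged one plus the bit length of the value that
it reads. Since no operation produces a value longer than what it reads (up to a constant that
depends on the program), this model and the multitape Turing machine simulate each other with
polynomial overhead. -/

/-- Values: natural numbers (held in binary) and ordered pairs of values. -/
inductive Value : Type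
  | num : ℕ → Value
  | pair : Value → Value → Value

/-- The bit length of a value. -/
def Value.size : Value → ℕ
  | .num n => Nat.size n + 1
  | .pair a b => a.size + b.size + 1

/-- Elementary operations. -/
inductive Op : Type
  | id
  | const (n : ℕ)
  | fst
  | snd
  | isNum
  | add
  | sub
  | mul
  | div
  | le

/-- The value of an elementary operation; it is `0` on arguments of the wrong shape. -/
def Op.apply : Op → Value → Value
  | .id, x => x
  | .const n, _ => .num n
  | .fst, .pair a _ => a
  | .snd, .pair _ b => b
  | .isNum, .num _ => .num 1
  | .add, .pair (.num a) (.num b) => .num (a + b)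
  | .sub, .pair (.num a) (.num b) => .num (a - b)
  | .mul, .pair (.num a) (.num b) => .num (a * b)
  | .div, .pair (.num a) (.num b) => .num (a / b)
  | .le, .pair (.num a) (.num b) => .num (if a ≤ b then 1 else 0)
  | _, _ => .num 0

/-- Programs; each of them computes a partial function from values to values. -/
inductive Prog : Type
  /-- an elementary operation -/
  | op : Op → Prog
  /-- `seq f g` runs `f`, and then `g` on the result of `f` -/
  | seq : Prog → Prog → Prog
  /-- `pair f g` runs `f` and `g` on the input and returns the pair of the results -/
  | pair : Prog → Prog → Prog
  /-- `cond c f g` runs `f` if the test `c` gives a value other than `0`, and `g` otherwise -/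
  | cond : Prog → Prog → Prog → Prog
  /-- `loop c f` replaces the value by its image under `f` as long as the test `c` does not
  give `0` -/
  | loop : Prog → Prog → Prog

/-- `Runs p x y t`: on input `x` the program `p` halts with output `y` after time `t`. -/
inductive Runs : Prog → Value → Value → ℕ → Prop
  | op (o : Op) (x : Value) : Runs (.op o) x (o.apply x) (x.size + 1)
  | seq {f g : Prog} {x y z : Value} {s t : ℕ} :
      Runs f x y s → Runs g y z t → Runs (.seq f g) x z (s + t + 1)
  | pair {f g : Prog} {x y z : Value} {s t : ℕ} :
      Runs f x y s → Runs g x z t → Runs (.pair f g) x (.pair y z) (s + t + 1)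
  | cond_true {c f g : Prog} {x b y : Value} {s t : ℕ} :
      Runs c x b s → b ≠ .num 0 → Runs f x y t → Runs (.cond c f g) x y (s + t + 1)
  | cond_false {c f g : Prog} {x y : Value} {s t : ℕ} :
      Runs c x (.num 0) s → Runs g x y t → Runs (.cond c f g) x y (s + t + 1)
  | loop_stop {c f : Prog} {x : Value} {s : ℕ} :
      Runs c x (.num 0) s → Runs (.loop c f) x x (s + 1)
  | loop_step {c f : Prog} {x b y z : Value} {r s t : ℕ} :
      Runs c x b r → b ≠ .num 0 → Runs f x y s → Runs (.loop c f) y z t →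
      Runs (.loop c f) x z (r + s + t + 1)

/-- There is a polynomial-time algorithm that on every instance `i` outputs some solution `o`
with `good i o`. Time is measured in the bit length of the encoded instance. -/
def PolyTimeSolvable {I : Type} {O : I → Type} (encI : I → Value)
    (encO : (i : I) → O i → Value) (good : (i : I) → O i → Prop) : Prop :=
  ∃ (p : Prog) (q : Polynomial ℕ), ∀ i : I, ∃ (o : O i) (t : ℕ),
    Runs p (encI i) (encO i o) t ∧ t ≤ q.eval (encI i).size ∧ good i o

/-! ## Encodings -/

/-- A list, as nested pairs that end in `0`. -/
def encList (l : List Value) : Value := l.foldr .pair (.num 0)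

/-- A finite sequence, as the list of its entries. -/
def encSeq {n : ℕ} (f : Fin n → Value) : Value := encList (List.ofFn f)

/-- A nonnegative rational number, as numerator and denominator in lowest terms. -/
def encRat (q : ℚ≥0) : Value := .pair (.num q.num) (.num q.den)

/-! ## Weighted graphs and partitions -/

/-- An undirected graph on the vertex set `{0, …, n - 1}` with nonnegative rational edge weights;
weight `0` stands for the absence of an edge. -/
structure WeightedGraph (n : ℕ) where
  weight : Fin n → Fin n → ℚ≥0
  symm : ∀ u v, weight u v = weight v u
  loopless : ∀ v, weight v v = 0

/-- The graph is encoded by its weight matrix. -/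
def WeightedGraph.enc {n : ℕ} (G : WeightedGraph n) : Value :=
  encSeq fun u => encSeq fun v => encRat (G.weight u v)

/-- `δ(S)`: the total weight of the edges between `S` and its complement. -/
def WeightedGraph.boundary {n : ℕ} (G : WeightedGraph n) (S : Finset (Fin n)) : ℚ≥0 :=
  ∑ u ∈ S, ∑ v ∈ Sᶜ, G.weight u v

/-- A partition of the vertices into `k` labelled parts, as the function that maps each vertex to
the label of its part. -/
abbrev Labelling (n k : ℕ) : Type := Fin n → Fin k

/-- The part with label `i`. -/
def Labelling.part {n k : ℕ} (P : Labelling n k) (i : Fin k) : Finset (Fin n) :=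
  Finset.univ.filter fun v => P v = i

/-- A partition is output as the list of the labels of the vertices. -/
def Labelling.enc {n k : ℕ} (P : Labelling n k) : Value :=
  encSeq fun v => .num (P v : ℕ)

/-- The min-max objective: the largest boundary of a part. -/
def WeightedGraph.maxBoundary {n k : ℕ} (G : WeightedGraph n) (P : Labelling n k) : ℚ≥0 :=
  Finset.univ.sup fun i => G.boundary (P.part i)

/-- The min-sum objective: the total weight of the edges whose ends lie in different parts. Each
edge is counted once, with its smaller end first. -/
def WeightedGraph.cutWeight {n k : ℕ} (G : WeightedGraph n) (P : Labelling n k) : ℚ≥0 :=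
  ∑ u, ∑ v, if u < v ∧ P u ≠ P v then G.weight u v else 0

/-! ## The two problems, for a fixed number `k` of parts -/

/-- An instance of Min-Max-Multiway-Cut: a weighted graph with `k` distinct terminals. -/
structure MultiwayInstance (k : ℕ) where
  n : ℕ
  graph : WeightedGraph n
  terminal : Fin k ↪ Fin n

def MultiwayInstance.enc {k : ℕ} (I : MultiwayInstance k) : Value :=
  .pair I.graph.enc (encSeq fun j => .num (I.terminal j : ℕ))

/-- Every part contains exactly one terminal. -/
def MultiwayInstance.Feasible {k : ℕ} (I : MultiwayInstance k) (P : Labelling I.n k) : Prop :=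
  ∀ i : Fin k, ∃! j : Fin k, I.terminal j ∈ P.part i

/-- There is a polynomial-time `ρ`-approximation algorithm for Min-Max-Multiway-Cut with `k`
terminals. -/
def HasMultiwayApprox (k : ℕ) (ρ : ℝ) : Prop :=
  PolyTimeSolvable (O := fun I : MultiwayInstance k => Labelling I.n k)
    (fun I => I.enc) (fun _ P => P.enc)
    (fun I P => I.Feasible P ∧ ∀ Q : Labelling I.n k, I.Feasible Q →
      (I.graph.maxBoundary P : ℝ) ≤ ρ * (I.graph.maxBoundary Q : ℝ))

/-- An instance of Min-Sum `k`-Partitioning: a weighted graph whose number of vertices is a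
multiple of `k`. -/
structure PartitionInstance (k : ℕ) where
  n : ℕ
  graph : WeightedGraph n
  dvd : k ∣ n

def PartitionInstance.enc {k : ℕ} (I : PartitionInstance k) : Value := I.graph.enc

/-- All parts have the same size. -/
def Labelling.Equal {n k : ℕ} (P : Labelling n k) : Prop :=
  ∀ i j : Fin k, (P.part i).card = (P.part j).card

/-- There is a polynomial-time `(α, β)` bicriteria approximation algorithm for Min-Sum
`k`-Partitioning. -/
def HasPartitionBicriteria (k : ℕ) (α β : ℝ) : Prop :=
  PolyTimeSolvable (O := fun I : PartitionInstance k => Labelling I.n k)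
    (fun I => I.enc) (fun _ P => P.enc)
    (fun I P => (∀ i : Fin k, ((P.part i).card : ℝ) ≤ β * (I.n : ℝ) / (k : ℝ)) ∧
      ∀ Q : Labelling I.n k, Q.Equal →
        (I.graph.cutWeight P : ℝ) ≤ α * (I.graph.cutWeight Q : ℝ))

end MinMaxCut

/-! Put A = 3^(2/ε) = 9^(1/ε), c + 1 = ⌊A⌋, γ = c + 1 and b = c + 2. Then b^ε ≥ 9, so the assumed
algorithm for b terminals has ratio at most b/9. If k ≤ γ, a single part holding all vertices is
good enough. Otherwise k ≥ b, and a large part is split repeatedly by a multiway cut with this fixed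
number b of terminals.

To split a part with m > cn/k vertices, join each of b new terminals to all its vertices by edges of
weight ω. A piece with s vertices then has boundary ω(m + cs) plus the weight it cuts inside the
part (`boundary_auxInstance`). Grouping the parts of an equipartition of weight OPT into b bins
gives a solution of value at most 3ωm + OPT (`pieces_le`). Hence the computed pieces have at most
m/2 vertices each once ωm ≥ OPT (`balanced`). The least power of two ω that gives balanced pieces
satisfies ωm < 2·OPT, apart from a rounding issue at ω = 1 that is removed by scaling the weights.
So a split costs O(b²)·OPT (`splitLabel_balanced`, `splitLabel_cut`).

The potential Σ max(0, 2k|S| − cn) over the parts S falls by at least cn per split, so there are at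
most 2k/c splits (`SplitInv.step`). With c ≥ 8 and b ≤ k the total cost is at most k²·OPT
(`splitIter_spec`). The final parts have at most cn/k vertices, and a greedy argument shows that
they fit into k bins of at most (c + 1)n/k vertices (`exists_table`).

For the running time, polynomial-time functions are closed under composition, branching and suitably
bounded loops. Since k is constant, the number of splits and the number of ways to merge the parts
are constants too. -/

namespace MinMaxCut

/-! ## Polynomial-time computable functions -/

/-- A program never returns much more than it spends time, and it spends time on its input. -/
theorem Runs.size_lt {p : Prog} {x y : Value} {t : ℕ} (h : Runs p x y t) : x.size < t := by
  induction h <;> omega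

theorem Value.one_le_size (v : Value) : 1 ≤ v.size := by
  cases v <;> simp [Value.size]

theorem Nat.size_add_le_size_add_size (a b : ℕ) : Nat.size (a + b) ≤ Nat.size a + Nat.size b + 1 := by
  rw [Nat.size_le]
  have ha := Nat.lt_size_self a
  have hb := Nat.lt_size_self b
  have h1 : 2 ^ Nat.size a ≤ 2 ^ (Nat.size a + Nat.size b) := Nat.pow_le_pow_right (by norm_num) (by omega)
  have h2 : 2 ^ Nat.size b ≤ 2 ^ (Nat.size a + Nat.size b) := Nat.pow_le_pow_right (by norm_num) (by omega)
  rw [pow_succ]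
  omega

theorem Nat.size_mul_le_size_add_size (a b : ℕ) : Nat.size (a * b) ≤ Nat.size a + Nat.size b := by
  rw [Nat.size_le, pow_add]
  exact Nat.mul_lt_mul'' (Nat.lt_size_self a) (Nat.lt_size_self b)

theorem Op.exists_size_apply_le (o : Op) : ∃ C, ∀ x, (o.apply x).size ≤ x.size + C := by
  refine ⟨1 + match o with | .const n => Nat.size n | _ => 0, fun x => ?_⟩
  have h0 := x.one_le_size
  have key : (o.apply x).size ≤ 2 ∨ (o.apply x).size ≤ x.size +
      (match o with | .const n => Nat.size n + 1 | _ => 0) := by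
    cases o
    case id => right; simp [Op.apply]
    case const n => right; simp [Op.apply, Value.size]
    case fst => rcases x with _ | ⟨a, b⟩ <;> simp [Op.apply, Value.size]; omega
    case snd => rcases x with _ | ⟨a, b⟩ <;> simp [Op.apply, Value.size]; omega
    case isNum => left; rcases x with _ | ⟨a, b⟩ <;> simp [Op.apply, Value.size]
    case add =>
      rcases x with _ | ⟨_ | _, _ | _⟩ <;> simp [Op.apply, Value.size]
      rename_i a b; have := Nat.size_add_le_size_add_size a b; omega
    case sub =>
      rcases x with _ | ⟨_ | _, _ | _⟩ <;> simp [Op.apply, Value.size]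
      rename_i a b; have := Nat.size_le_size (Nat.sub_le a b); omega
    case mul =>
      rcases x with _ | ⟨_ | _, _ | _⟩ <;> simp [Op.apply, Value.size]
      rename_i a b; have := Nat.size_mul_le_size_add_size a b; omega
    case div =>
      rcases x with _ | ⟨_ | _, _ | _⟩ <;> simp [Op.apply, Value.size]
      rename_i a b; have := Nat.size_le_size (Nat.div_le_self a b); omega
    case le =>
      left
      rcases x with _ | ⟨_ | _, _ | _⟩ <;> simp [Op.apply, Value.size]
      split_ifs <;> simp
  cases o <;> simp at key ⊢ <;> omega

/-- Output length is controlled by running time, which is what makes polynomial time closed under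
composition. -/
theorem Prog.exists_size_le (p : Prog) : ∃ C, ∀ x y t, Runs p x y t → y.size ≤ t + C := by
  induction p with
  | op o =>
    obtain ⟨C, hC⟩ := o.exists_size_apply_le
    refine ⟨C, fun x y t h => ?_⟩
    cases h
    have := hC x
    omega
  | seq f g _ hg =>
    obtain ⟨C, hC⟩ := hg
    refine ⟨C, fun x y t h => ?_⟩
    cases h with
    | seq h1 h2 => have := hC _ _ _ h2; omega
  | pair f g hf hg =>
    obtain ⟨C, hC⟩ := hf
    obtain ⟨C', hC'⟩ := hg
    refine ⟨C + C', fun x y t h => ?_⟩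
    cases h with
    | pair h1 h2 =>
      have := hC _ _ _ h1
      have := hC' _ _ _ h2
      simp only [Value.size]
      omega
  | cond c f g _ hf hg =>
    obtain ⟨C, hC⟩ := hf
    obtain ⟨C', hC'⟩ := hg
    refine ⟨C + C', fun x y t h => ?_⟩
    cases h with
    | cond_true h1 _ h2 => have := hC _ _ _ h2; omega
    | cond_false h1 h2 => have := hC' _ _ _ h2; omega
  | loop c f _ _ =>
    -- The last test of a loop reads its output, so no constant accumulates over the rounds.
    refine ⟨0, fun x y t h => ?_⟩
    generalize hp : Prog.loop c f = p at h
    induction h with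
    | loop_stop h1 => have := h1.size_lt; omega
    | loop_step _ _ _ _ _ _ ih => have := ih hp; omega
    | _ => cases hp

/-- `f x` is computed from `e x` in polynomial time. -/
def PolyE {X : Type} (e f : X → Value) : Prop :=
  ∃ (p : Prog) (q : Polynomial ℕ), ∀ x, ∃ t, Runs p (e x) (f x) t ∧ t ≤ q.eval (e x).size

/-- The number `n x` is bounded by a polynomial in the size of `e x`. -/
def PolyBdd {X : Type} (e : X → Value) (n : X → ℕ) : Prop :=
  ∃ q : Polynomial ℕ, ∀ x, n x ≤ q.eval (e x).size

theorem Polynomial.eval_mono_nat (q : Polynomial ℕ) : Monotone fun n => q.eval n := by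
  intro a b h
  simp only [Polynomial.eval_eq_sum_range]
  gcongr

section

variable {X Y : Type} {e f g : X → Value}

namespace PolyBdd

variable {m n : X → ℕ}

theorem mono (hn : PolyBdd e n) (h : ∀ x, m x ≤ n x) : PolyBdd e m := by
  obtain ⟨q, hq⟩ := hn
  exact ⟨q, fun x => (h x).trans (hq x)⟩

theorem const (c : ℕ) : PolyBdd e fun _ => c := ⟨.C c, fun x => by simp⟩

theorem size : PolyBdd e fun x => (e x).size := ⟨.X, fun x => by simp⟩

theorem add (hm : PolyBdd e m) (hn : PolyBdd e n) : PolyBdd e fun x => m x + n x := by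
  obtain ⟨q, hq⟩ := hm
  obtain ⟨r, hr⟩ := hn
  exact ⟨q + r, fun x => by simpa using add_le_add (hq x) (hr x)⟩

theorem mul (hm : PolyBdd e m) (hn : PolyBdd e n) : PolyBdd e fun x => m x * n x := by
  obtain ⟨q, hq⟩ := hm
  obtain ⟨r, hr⟩ := hn
  exact ⟨q * r, fun x => by simpa using Nat.mul_le_mul (hq x) (hr x)⟩

theorem trans (hn : PolyBdd f n) (hf : PolyBdd e fun x => (f x).size) : PolyBdd e n := by
  obtain ⟨q, hq⟩ := hn
  obtain ⟨r, hr⟩ := hf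
  exact ⟨q.comp r, fun x => (hq x).trans (by
    simpa using Polynomial.eval_mono_nat q (hr x))⟩

end PolyBdd

/-- Time bounds may be arbitrary functions below a polynomial, so they can be combined without
handling explicit polynomials. -/
theorem PolyE.iff_polyBdd : PolyE e f ↔
    ∃ (p : Prog) (n : X → ℕ), PolyBdd e n ∧ ∀ x, ∃ t, Runs p (e x) (f x) t ∧ t ≤ n x := by
  constructor
  · rintro ⟨p, q, h⟩
    exact ⟨p, fun x => q.eval (e x).size, ⟨q, fun x => le_rfl⟩, h⟩
  · rintro ⟨p, n, ⟨q, hq⟩, h⟩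
    refine ⟨p, q, fun x => ?_⟩
    obtain ⟨t, h1, h2⟩ := h x
    exact ⟨t, h1, h2.trans (hq x)⟩

namespace PolyE

theorem size_bdd (hf : PolyE e f) : PolyBdd e fun x => (f x).size := by
  obtain ⟨p, q, h⟩ := hf
  obtain ⟨C, hC⟩ := p.exists_size_le
  refine ⟨q + .C C, fun x => ?_⟩
  obtain ⟨t, h1, h2⟩ := h x
  have := hC _ _ _ h1
  simp
  omega

theorem comap (hf : PolyE e f) (φ : Y → X) : PolyE (fun y => e (φ y)) fun y => f (φ y) := by
  obtain ⟨p, q, h⟩ := hf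
  exact ⟨p, q, fun y => h (φ y)⟩

theorem op (o : Op) : PolyE e fun x => o.apply (e x) :=
  ⟨.op o, .X + .C 1, fun x => ⟨_, .op o _, by simp⟩⟩

protected theorem id : PolyE e e := op .id

theorem comp (hf : PolyE e f) (hg : PolyE f g) : PolyE e g := by
  have hb := hf.size_bdd
  obtain ⟨p, n, hn, h⟩ := iff_polyBdd.1 hf
  obtain ⟨p', n', hn', h'⟩ := iff_polyBdd.1 hg
  refine iff_polyBdd.2 ⟨.seq p p', _, (hn.add (hn'.trans hb)).add (.const 1), fun x => ?_⟩
  obtain ⟨t, h1, h2⟩ := h x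
  obtain ⟨t', h1', h2'⟩ := h' x
  exact ⟨_, .seq h1 h1', by omega⟩

theorem app (o : Op) (hf : PolyE e f) : PolyE e fun x => o.apply (f x) := hf.comp (op o)

theorem const (c : ℕ) : PolyE e fun _ => .num c := op (.const c)

theorem pair (hf : PolyE e f) (hg : PolyE e g) : PolyE e fun x => .pair (f x) (g x) := by
  obtain ⟨p, n, hn, h⟩ := iff_polyBdd.1 hf
  obtain ⟨p', n', hn', h'⟩ := iff_polyBdd.1 hg
  refine iff_polyBdd.2 ⟨.pair p p', _, (hn.add hn').add (.const 1), fun x => ?_⟩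
  obtain ⟨t, h1, h2⟩ := h x
  obtain ⟨t', h1', h2'⟩ := h' x
  exact ⟨_, .pair h1 h1', by omega⟩

theorem fst (hf : PolyE e fun x => .pair (f x) (g x)) : PolyE e f := hf.app .fst

theorem snd (hf : PolyE e fun x => .pair (f x) (g x)) : PolyE e g := hf.app .snd

theorem ite {P : X → Prop} [DecidablePred P] {c : X → ℕ} (hc : PolyE e fun x => .num (c x))
    (hP : ∀ x, c x ≠ 0 ↔ P x) (hf : PolyE e f) (hg : PolyE e g) :
    PolyE e fun x => if P x then f x else g x := by
  obtain ⟨p, n, hn, h⟩ := iff_polyBdd.1 hf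
  obtain ⟨p', n', hn', h'⟩ := iff_polyBdd.1 hg
  obtain ⟨r, k, hk, hr⟩ := iff_polyBdd.1 hc
  refine iff_polyBdd.2 ⟨.cond r p p', _, ((hn.add hn').add hk).add (.const 1), fun x => ?_⟩
  obtain ⟨t, h1, h2⟩ := h x
  obtain ⟨t', h1', h2'⟩ := h' x
  obtain ⟨s, h3, h4⟩ := hr x
  by_cases hx : P x
  · simp only [hx, if_true]
    exact ⟨_, .cond_true h3 (by simpa using (hP x).2 hx) h1, by omega⟩
  · simp only [hx, if_false]
    have : c x = 0 := by by_contra h0; exact hx ((hP x).1 h0)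
    rw [this] at h3
    exact ⟨_, .cond_false h3 h1', by omega⟩

theorem _root_.MinMaxCut.Runs.iterate {c b : Prog} {T : ℕ} (N : ℕ) (st test : ℕ → Value)
    (hc : ∀ i ≤ N, ∃ t, Runs c (st i) (test i) t ∧ t ≤ T)
    (hb : ∀ i < N, ∃ t, Runs b (st i) (st (i + 1)) t ∧ t ≤ T)
    (h1 : ∀ i < N, test i ≠ .num 0) (h0 : test N = .num 0) :
    ∃ t, Runs (.loop c b) (st 0) (st N) t ∧ t ≤ (N + 1) * (2 * T + 1) := by
  induction N generalizing st test with
  | zero =>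
    obtain ⟨t, ht, hT⟩ := hc 0 le_rfl
    rw [h0] at ht
    exact ⟨_, Runs.loop_stop ht, by omega⟩
  | succ N ih =>
    obtain ⟨t, ht, htT⟩ := hc 0 (by omega)
    obtain ⟨s, hs, hsT⟩ := hb 0 (by omega)
    obtain ⟨r, hr, hrT⟩ := ih (fun i => st (i + 1)) (fun i => test (i + 1))
      (fun i hi => hc _ (by omega)) (fun i hi => hb _ (by omega))
      (fun i hi => h1 _ (by omega)) h0
    refine ⟨_, .loop_step ht (h1 0 (by omega)) hs hr, ?_⟩
    nlinarith

/-- A polynomial number of rounds is not enough, since repeated squaring makes values explode. Hence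
the separate bound `B` on all intermediate states. -/
theorem loop {st test : X → ℕ → Value} {N : X → ℕ}
    (hc : PolyE (fun p : X × ℕ => st p.1 p.2) fun p => test p.1 p.2)
    (hb : PolyE (fun p : X × ℕ => st p.1 p.2) fun p => st p.1 (p.2 + 1))
    (h1 : ∀ x, ∀ i < N x, test x i ≠ .num 0) (h0 : ∀ x, test x (N x) = .num 0)
    (hN : PolyBdd (fun x => st x 0) N) {B : X → ℕ}
    (hB : PolyBdd (fun x => st x 0) B) (hs : ∀ x, ∀ i ≤ N x, (st x i).size ≤ B x) :
    PolyE (fun x => st x 0) fun x => st x (N x) := by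
  obtain ⟨c, q, hc⟩ := hc
  obtain ⟨b, r, hb⟩ := hb
  have hT : PolyBdd (fun x => st x 0) fun x => (q + r).eval (B x) := by
    obtain ⟨s, hs⟩ := hB
    exact ⟨(q + r).comp s, fun x => by
      rw [Polynomial.eval_comp]; exact Polynomial.eval_mono_nat _ (hs x)⟩
  refine iff_polyBdd.2 ⟨.loop c b, _, (hN.add (.const 1)).mul (((PolyBdd.const 2).mul hT).add (.const 1)),
    fun x => ?_⟩
  refine Runs.iterate (N x) (st x) (test x) (fun i hi => ?_) (fun i hi => ?_) (h1 x) (h0 x)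
  · obtain ⟨t, h2, h3⟩ := hc (x, i)
    have := Polynomial.eval_mono_nat q (hs x i hi)
    simp at h3 this ⊢
    exact ⟨t, h2, by omega⟩
  · obtain ⟨t, h2, h3⟩ := hb (x, i)
    have := Polynomial.eval_mono_nat r (hs x i hi.le)
    simp at h3 this ⊢
    exact ⟨t, h2, by omega⟩

end PolyE

end

section

variable {X Y : Type} {e f g : X → Value}

/-! ## Numbers and predicates -/

/-- The number `n x` is computed from `e x` in polynomial time. -/
def PolyN {X : Type} (e : X → Value) (n : X → ℕ) : Prop := PolyE e fun x => .num (n x)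

/-- The predicate `P` is decided in polynomial time. -/
def PolyP {X : Type} (e : X → Value) (P : X → Prop) : Prop :=
  ∃ c : X → ℕ, PolyN e c ∧ ∀ x, c x ≠ 0 ↔ P x

/-- The context `e` extended by a number. -/
def ext {X : Type} (e : X → Value) : X × ℕ → Value := fun p => .pair (.num p.2) (e p.1)

theorem PolyE.weaken (hf : PolyE e f) : PolyE (ext e) fun p => f p.1 :=
  (PolyE.snd (f := fun p : X × ℕ => .num p.2) PolyE.id).comp (hf.comap Prod.fst)

theorem PolyBdd.weaken {n : X → ℕ} (hn : PolyBdd e n) : PolyBdd (ext e) fun p => n p.1 := by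
  obtain ⟨q, hq⟩ := hn
  refine ⟨q, fun p => (hq p.1).trans (Polynomial.eval_mono_nat q ?_)⟩
  simp only [ext, Value.size]
  omega

/-- A bound in an extended context that holds uniformly for small numbers. -/
theorem PolyBdd.exists_uniform {m : X × ℕ → ℕ} {n : X → ℕ} (hm : PolyBdd (ext e) m)
    (hn : PolyBdd e n) : ∃ B : X → ℕ, PolyBdd e B ∧ ∀ x, ∀ i ≤ n x, m (x, i) ≤ B x := by
  obtain ⟨q, hq⟩ := hm
  obtain ⟨r, hr⟩ := hn
  refine ⟨fun x => q.eval (r.eval (e x).size + 2 + (e x).size),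
    ⟨q.comp (r + .C 2 + .X), fun x => by simp⟩, fun x i hi => (hq (x, i)).trans ?_⟩
  apply Polynomial.eval_mono_nat q
  have h1 : Nat.size i ≤ i := by
    rw [Nat.size_le]; exact Nat.lt_two_pow_self
  have := hr x
  simp only [ext, Value.size]
  omega

namespace PolyN

variable {m n : X → ℕ} {P : X → Prop}

theorem const (c : ℕ) : PolyN e fun _ => c := PolyE.const c

theorem weaken (hn : PolyN e n) : PolyN (ext e) fun p => n p.1 := PolyE.weaken hn

theorem var : PolyN (ext e) fun p => p.2 := PolyE.fst (g := fun p => e p.1) PolyE.id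

theorem add (hm : PolyN e m) (hn : PolyN e n) : PolyN e fun x => m x + n x :=
  (PolyE.pair hm hn).app .add

theorem sub (hm : PolyN e m) (hn : PolyN e n) : PolyN e fun x => m x - n x :=
  (PolyE.pair hm hn).app .sub

theorem mul (hm : PolyN e m) (hn : PolyN e n) : PolyN e fun x => m x * n x :=
  (PolyE.pair hm hn).app .mul

theorem div (hm : PolyN e m) (hn : PolyN e n) : PolyN e fun x => m x / n x :=
  (PolyE.pair hm hn).app .div

theorem ite [DecidablePred P] (hP : PolyP e P) (hm : PolyN e m) (hn : PolyN e n) :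
    PolyN e fun x => if P x then m x else n x := by
  obtain ⟨c, hc, h⟩ := hP
  have := PolyE.ite hc h hm hn
  unfold PolyN
  convert this using 2 with x
  show Value.num (if P x then m x else n x) = _
  split_ifs <;> rfl

end PolyN

namespace PolyP

variable {m n : X → ℕ} {P Q : X → Prop}

theorem le (hm : PolyN e m) (hn : PolyN e n) : PolyP e fun x => m x ≤ n x :=
  ⟨_, (PolyE.pair hm hn).app .le, fun x => by simp⟩

theorem not (hP : PolyP e P) : PolyP e fun x => ¬ P x := by
  obtain ⟨c, hc, h⟩ := hP
  exact ⟨_, (PolyN.const 1).sub hc, fun x => by simp only [← h x]; omega⟩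

theorem and (hP : PolyP e P) (hQ : PolyP e Q) : PolyP e fun x => P x ∧ Q x := by
  obtain ⟨c, hc, h⟩ := hP
  obtain ⟨d, hd, h'⟩ := hQ
  exact ⟨_, hc.mul hd, fun x => by simp only [← h x, ← h' x]; simp⟩

theorem lt (hm : PolyN e m) (hn : PolyN e n) : PolyP e fun x => m x < n x := by
  simpa using (le hn hm).not

theorem eq (hm : PolyN e m) (hn : PolyN e n) : PolyP e fun x => m x = n x := by
  simpa only [le_antisymm_iff] using (le hm hn).and (le hn hm)

theorem weaken (hP : PolyP e P) : PolyP (ext e) fun p => P p.1 := by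
  obtain ⟨c, hc, h⟩ := hP
  exact ⟨_, hc.weaken, fun p => h p.1⟩

end PolyP

/-! ## Loops -/

/-- Primitive recursion on a counter that runs down from `n x`, with additive growth. -/
theorem PolyE.rec {n : X → ℕ} (hn : PolyN e n) (hnb : PolyBdd e n) {G : X → ℕ → Value → Value}
    (hG : PolyE (fun p : (X × ℕ) × Value => .pair (ext e p.1) p.2) fun p => G p.1.1 p.1.2 p.2)
    {b : X × ℕ → ℕ} (hb : PolyBdd (ext e) b) (hs : ∀ x i v, (G x i v).size ≤ v.size + b (x, i))
    {acc : X → ℕ → Value} (c : ℕ) (h0 : ∀ x, acc x 0 = .num c)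
    (h1 : ∀ x j, acc x (j + 1) = G x (n x - (j + 1)) (acc x j)) :
    PolyE e fun x => acc x (n x) := by
  obtain ⟨B, hB, hbB⟩ := hb.exists_uniform hnb
  -- The remaining count serves as the loop test. Running downwards also builds lists from their
  -- last entry to their first.
  let st : X → ℕ → Value := fun x j => .pair (ext e (x, n x - j)) (acc x j)
  have hst : PolyE e fun x => st x 0 := by
    simp only [st, h0]
    exact (PolyE.pair (PolyE.pair hn PolyE.id) (const c))
  have hsz : PolyBdd (fun x => st x 0) fun x => (e x).size :=
    (PolyBdd.size (e := fun x => st x 0)).mono fun x => by simp [st, ext, Value.size]; omega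
  have hacc : ∀ x j, (acc x j).size ≤ j * B x + (Value.num c).size := by
    intro x j
    induction j with
    | zero => simp [h0]
    | succ j ih =>
      rw [h1]
      have := hs x (n x - (j + 1)) (acc x j)
      have := hbB x (n x - (j + 1)) (by omega)
      rw [add_mul]
      omega
  have hsub : PolyN (fun p : X × ℕ => st p.1 p.2) fun p => n p.1 - p.2 :=
    PolyE.fst (g := fun p => e p.1) (PolyE.fst (g := fun p => acc p.1 p.2) PolyE.id)
  have hpred : PolyN (fun p : X × ℕ => st p.1 p.2) fun p => n p.1 - (p.2 + 1) := by
    simpa only [Nat.sub_sub] using hsub.sub (.const 1)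
  have hext : PolyE (fun p : X × ℕ => st p.1 p.2) fun p => ext e (p.1, n p.1 - (p.2 + 1)) :=
    PolyE.pair hpred (PolyE.snd (f := fun p => .num (n p.1 - p.2))
      (PolyE.fst (g := fun p => acc p.1 p.2) PolyE.id))
  have hlast : PolyE (fun p : X × ℕ => st p.1 p.2) fun p => acc p.1 p.2 :=
    PolyE.snd (f := fun p : X × ℕ => ext e (p.1, n p.1 - p.2)) PolyE.id
  have hloop := PolyE.loop (st := st) (N := n) (test := fun x i => .num (n x - i)) hsub (by
      have := (hext.pair hlast).comp (hG.comap fun p : X × ℕ => ((p.1, n p.1 - (p.2 + 1)), acc p.1 p.2))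
      simp only [st, h1]
      exact hext.pair this) (fun x i hi => by simp; omega) (fun x => by simp)
    (hnb.trans hsz) (B := fun x => (n x + 1 + 1 + (e x).size) + (n x * B x + (Value.num c).size) + 1)
    ((((((hnb.add (.const 1)).add (.const 1)).add .size).add ((hnb.mul hB).add (.const _))).add (.const 1)).trans hsz)
    (fun x i hi => by
      have h2 := hacc x i
      have h3 : i * B x ≤ n x * B x := Nat.mul_le_mul_right _ hi
      have h4 : Nat.size (n x - i) ≤ n x := by
        rw [Nat.size_le]; exact lt_of_le_of_lt (Nat.sub_le _ _) Nat.lt_two_pow_self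
      simp only [st, ext, Value.size] at h2 ⊢
      omega)
  exact PolyE.snd (f := fun x => ext e (x, n x - n x)) (hst.comp hloop)

theorem PolyN.sum {n : X → ℕ} (hn : PolyN e n) (hnb : PolyBdd e n) {F : X → ℕ → ℕ}
    (hF : PolyN (ext e) fun p => F p.1 p.2) :
    PolyN e fun x => ∑ i ∈ Finset.range (n x), F x i := by
  have h := PolyE.rec hn hnb (G := fun x i v => Op.add.apply (.pair (.num (F x i)) v))
    (PolyE.app .add ((PolyE.fst PolyE.id).comp (hF.comap Prod.fst) |>.pair (PolyE.snd (f := fun p : (X × ℕ) × Value => ext e p.1) PolyE.id)))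
    (hF.size_bdd.add (.const 1)) (fun x i v => by
      have h0 := v.one_le_size
      rcases v with a | _
      · have := Nat.size_add_le_size_add_size (F x i) a
        simp only [Op.apply, Value.size]; omega
      · simp only [Op.apply, Value.size, Nat.size_zero]; omega) (acc := fun x j => .num (∑ i ∈ Finset.range j, F x (n x - (i + 1)))) 0
    (fun x => by simp) (fun x j => by simp [Op.apply, Finset.sum_range_succ, add_comm])
  unfold PolyN
  convert h using 3 with x
  refine (Finset.sum_range_reflect (fun i => F x i) (n x)).symm.trans ?_
  simp only [Nat.sub_sub, add_comm 1]

theorem PolyN.prod {n : X → ℕ} (hn : PolyN e n) (hnb : PolyBdd e n) {F : X → ℕ → ℕ}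
    (hF : PolyN (ext e) fun p => F p.1 p.2) :
    PolyN e fun x => ∏ i ∈ Finset.range (n x), F x i := by
  have h := PolyE.rec hn hnb (G := fun x i v => Op.mul.apply (.pair (.num (F x i)) v))
    (PolyE.app .mul ((PolyE.fst PolyE.id).comp (hF.comap Prod.fst) |>.pair (PolyE.snd (f := fun p : (X × ℕ) × Value => ext e p.1) PolyE.id)))
    (hF.size_bdd.add (.const 1)) (fun x i v => by
      have h0 := v.one_le_size
      rcases v with a | _
      · have := Nat.size_mul_le_size_add_size (F x i) a
        simp only [Op.apply, Value.size]; omega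
      · simp only [Op.apply, Value.size, Nat.size_zero]; omega) (acc := fun x j => .num (∏ i ∈ Finset.range j, F x (n x - (i + 1)))) 1
    (fun x => by simp) (fun x j => by simp [Op.apply, Finset.prod_range_succ, mul_comm])
  unfold PolyN
  convert h using 3 with x
  refine (Finset.prod_range_reflect (fun i => F x i) (n x)).symm.trans ?_
  simp only [Nat.sub_sub, add_comm 1]

theorem PolyE.tabulate {n : X → ℕ} (hn : PolyN e n) (hnb : PolyBdd e n) {F : X → ℕ → Value}
    (hF : PolyE (ext e) fun p => F p.1 p.2) :
    PolyE e fun x => encSeq fun i : Fin (n x) => F x i := by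
  have h := PolyE.rec hn hnb (G := fun x i v => .pair (F x i) v)
    ((PolyE.fst PolyE.id).comp (hF.comap Prod.fst) |>.pair (PolyE.snd (f := fun p : (X × ℕ) × Value => ext e p.1) PolyE.id))
    (hF.size_bdd.add (.const 1)) (fun x i v => by simp only [Value.size]; omega)
    (acc := fun x j => encList ((List.range j).reverse.map fun i => F x (n x - (i + 1)))) 0
    (fun x => by simp [encList]) (fun x j => by simp [encList, List.range_succ])
  convert h using 2 with x
  unfold encSeq
  congr 1
  apply List.ext_getElem
  · simp
  · intro i h1 h2
    simp at h1
    simp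
    congr 1
    omega

/-! ### Encoded lists: suffixes, entries and length -/

theorem length_le_size (l : List Value) : l.length ≤ (encList l).size := by
  induction l with
  | nil => simp
  | cons a l ih => simp [encList, Value.size] at ih ⊢; omega

theorem size_drop_le (l : List Value) (i : ℕ) : (encList (l.drop i)).size ≤ (encList l).size := by
  induction l generalizing i with
  | nil => simp
  | cons a l ih =>
    cases i with
    | zero => simp
    | succ i => have := ih i; simp [encList, Value.size] at this ⊢; omega

theorem snd_encList_drop (l : List Value) (i : ℕ) :
    Op.snd.apply (encList (l.drop i)) = encList (l.drop (i + 1)) := by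
  rw [← List.tail_drop]
  cases l.drop i <;> rfl

theorem isNum_encList_drop (l : List Value) (i : ℕ) :
    Op.isNum.apply (encList (l.drop i)) = .num (if l.length ≤ i then 1 else 0) := by
  by_cases h : l.length ≤ i
  · simp [List.drop_eq_nil_of_le h, h, encList, Op.apply]
  · rw [List.drop_eq_getElem_cons (by omega), if_neg h]
    rfl

theorem fst_encList_drop (l : List Value) (i : ℕ) :
    Op.fst.apply (encList (l.drop i)) = l.getD i (.num 0) := by
  by_cases h : l.length ≤ i
  · rw [List.drop_eq_nil_of_le h, List.getD_eq_default _ _ h]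
    rfl
  · rw [List.drop_eq_getElem_cons (by omega), List.getD_eq_getElem _ _ (by omega)]
    rfl

theorem PolyE.drop {l : X → List Value} (hl : PolyE e fun x => encList (l x)) {n : X → ℕ}
    (hn : PolyN e n) : PolyE e fun x => encList ((l x).drop (n x)) := by
  let st : X → ℕ → Value := fun x j => .pair (.num (n x - j)) (encList ((l x).drop j))
  have h1 : PolyN (fun p : X × ℕ => st p.1 p.2) fun p => n p.1 - p.2 :=
    PolyE.fst (g := fun p => encList ((l p.1).drop p.2)) PolyE.id
  have h2 : PolyE (fun p : X × ℕ => st p.1 p.2) fun p => encList ((l p.1).drop p.2) :=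
    PolyE.snd (f := fun p => .num (n p.1 - p.2)) PolyE.id
  have h3 : PolyN (fun p : X × ℕ => st p.1 p.2) fun p => if (l p.1).length ≤ p.2 then 1 else 0 := by
    have := h2.app .isNum
    simpa only [isNum_encList_drop, PolyN] using this
  have hst : PolyE e fun x => st x 0 := by simpa [st] using PolyE.pair hn hl
  -- The index is in binary and may be exponentially large, so the loop also stops when the list is
  -- exhausted.
  have hloop := PolyE.loop (st := st) (N := fun x => min (n x) (l x).length)
    (test := fun x i => .num ((n x - i) * (1 - if (l x).length ≤ i then 1 else 0)))
    (h1.mul ((PolyN.const 1).sub h3))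
    (by
      refine PolyE.pair ?_ ?_
      · simpa only [Nat.sub_sub, PolyN] using h1.sub (.const 1)
      · simpa only [snd_encList_drop] using h2.app .snd)
    (fun x i hi => by
      have h4 : i < n x ∧ ¬ (l x).length ≤ i := by simpa using hi
      simp only [if_neg h4.2, ne_eq, Value.num.injEq]; omega)
    (fun x => by
      rcases le_total (n x) (l x).length with h | h <;> simp [h])
    (PolyBdd.size.mono fun x => by
      have := length_le_size (l x)
      simp [st, Value.size]; omega)
    (B := fun x => (st x 0).size) .size (fun x i _ => by
      have := size_drop_le (l x) i
      have := Nat.size_le_size (Nat.sub_le (n x) i)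
      simp only [st, Value.size, List.drop_zero, Nat.sub_zero]; omega)
  have h4 := PolyE.snd (f := fun x => .num (n x - min (n x) (l x).length)) (hst.comp hloop)
  convert h4 using 2 with x
  rcases le_total (n x) (l x).length with h | h
  · rw [min_eq_left h]
  · rw [min_eq_right h, List.drop_length, List.drop_eq_nil_of_le h]

/-- Access to an entry of a list, with default value `0`. -/
theorem PolyE.getD {l : X → List Value} (hl : PolyE e fun x => encList (l x)) {n : X → ℕ}
    (hn : PolyN e n) : PolyE e fun x => (l x).getD (n x) (.num 0) := by
  simpa only [fst_encList_drop] using (hl.drop hn).app .fst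

theorem PolyE.length {l : X → List Value} (hl : PolyE e fun x => encList (l x)) :
    PolyN e fun x => (l x).length := by
  let st : X → ℕ → Value := fun x j => .pair (.num j) (encList ((l x).drop j))
  have h1 : PolyN (fun p : X × ℕ => st p.1 p.2) fun p => p.2 :=
    PolyE.fst (g := fun p => encList ((l p.1).drop p.2)) PolyE.id
  have h2 : PolyE (fun p : X × ℕ => st p.1 p.2) fun p => encList ((l p.1).drop p.2) :=
    PolyE.snd (f := fun p => .num p.2) PolyE.id
  have h3 : PolyN (fun p : X × ℕ => st p.1 p.2) fun p => if (l p.1).length ≤ p.2 then 1 else 0 := by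
    have := h2.app .isNum
    simpa only [isNum_encList_drop, PolyN] using this
  have hst : PolyE e fun x => st x 0 := by simpa [st] using PolyE.pair (.const 0) hl
  have hloop := PolyE.loop (st := st) (N := fun x => (l x).length)
    (test := fun x i => .num (1 - if (l x).length ≤ i then 1 else 0))
    ((PolyN.const 1).sub h3)
    (by
      refine PolyE.pair ?_ ?_
      · exact h1.add (.const 1)
      · simpa only [snd_encList_drop] using h2.app .snd)
    (fun x i hi => by simp [not_le.2 hi])
    (fun x => by simp)
    (PolyBdd.size.mono fun x => by
      have := length_le_size (l x)
      simp [st, Value.size]; omega)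
    (B := fun x => 2 * (st x 0).size) ((PolyBdd.const 2).mul .size) (fun x i hi => by
      have h3 := size_drop_le (l x) i
      have h4 := length_le_size (l x)
      have h5 : Nat.size i ≤ i := by
        rw [Nat.size_le]; exact Nat.lt_two_pow_self
      simp only [st, Value.size, List.drop_zero]; omega)
  exact PolyE.fst (g := fun x => encList ((l x).drop (l x).length)) (hst.comp hloop)

/-- The least power of two that violates `C` or is at least `T`. -/
theorem exists_search {C : ℕ → Prop} (T : ℕ) : ∃ i, ¬ (C (2 ^ i) ∧ 2 ^ i < T) :=
  ⟨T, fun h => absurd h.2 (not_lt.2 Nat.lt_two_pow_self.le)⟩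

open Classical in
/-- The exponent of the least power of two that violates `C` or is at least `T`. -/
noncomputable def searchExp (C : ℕ → Prop) (T : ℕ) : ℕ := Nat.find (exists_search (C := C) T)

theorem searchExp_le (C : ℕ → Prop) (T : ℕ) : searchExp C T ≤ T.size := by
  classical
  exact Nat.find_min' _ fun h => absurd h.2 (not_lt.2 T.lt_size_self.le)

theorem searchExp_spec (C : ℕ → Prop) (T : ℕ) :
    ¬ (C (2 ^ searchExp C T) ∧ 2 ^ searchExp C T < T) := by
  classical
  exact Nat.find_spec (exists_search (C := C) T)

theorem searchExp_min (C : ℕ → Prop) (T : ℕ) {i : ℕ} (hi : i < searchExp C T) :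
    C (2 ^ i) ∧ 2 ^ i < T := by
  classical
  exact not_not.1 (Nat.find_min (exists_search (C := C) T) hi)

/-- Doubling reaches `T` after at most its bit length many rounds. No monotonicity of `C` is needed.
-/
theorem PolyN.search {T : X → ℕ} (hT : PolyN e T) {C : X → ℕ → Prop}
    (hC : PolyP (ext e) fun p => C p.1 p.2) :
    PolyN e fun x => 2 ^ searchExp (C x) (T x) := by
  obtain ⟨c, hc, h⟩ := hC.and (PolyP.lt PolyN.var hT.weaken)
  let st : X → ℕ → Value := fun x j => ext e (x, 2 ^ j)
  have hst : PolyE e fun x => st x 0 := by simpa [st, ext] using PolyE.pair (.const 1) PolyE.id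
  have hsz : PolyBdd (fun x => st x 0) fun x => (e x).size :=
    PolyBdd.size.mono fun x => by simp [st, ext, Value.size]; omega
  have hN : PolyBdd e fun x => (Value.num (T x)).size := hT.size_bdd
  have hloop := PolyE.loop (st := st) (N := fun x => searchExp (C x) (T x))
    (test := fun x i => .num (c (x, 2 ^ i)))
    (hc.comap fun p : X × ℕ => (p.1, 2 ^ p.2))
    (by
      have h1 : PolyN (fun p : X × ℕ => st p.1 p.2) fun p => 2 ^ p.2 :=
        PolyE.fst (g := fun p => e p.1) PolyE.id
      have h2 : PolyE (fun p : X × ℕ => st p.1 p.2) fun p => e p.1 :=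
        PolyE.snd (f := fun p : X × ℕ => .num (2 ^ p.2)) PolyE.id
      simp only [st, ext, pow_succ]
      exact (h1.mul (.const 2)).pair h2)
    (fun x i hi => by simpa using (h (x, 2 ^ i)).2 (searchExp_min _ _ hi))
    (fun x => by
      have := (h (x, 2 ^ searchExp (C x) (T x))).not.2 (searchExp_spec _ _)
      simpa using this)
    ((hN.mono fun x => by
      have := searchExp_le (C x) (T x)
      simp only [Value.size]; omega).trans hsz)
    (B := fun x => (Value.num (T x)).size + (e x).size + 2)
    (((hN.add .size).add (.const 2)).trans hsz)
    (fun x i hi => by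
      have := searchExp_le (C x) (T x)
      simp only [st, ext, Value.size, Nat.size_pow]
      omega)
  exact PolyE.fst (g := e) (hst.comp hloop)

theorem PolyP.exists_lt {n : X → ℕ} (hn : PolyN e n) (hnb : PolyBdd e n) {C : X → ℕ → Prop}
    (hC : PolyP (ext e) fun p => C p.1 p.2) : PolyP e fun x => ∃ i < n x, C x i := by
  obtain ⟨c, hc, h⟩ := hC
  refine ⟨_, PolyN.sum hn hnb (F := fun x i => c (x, i)) hc, fun x => ?_⟩
  simp [Finset.sum_eq_zero_iff, ← h (x, _)]

end

/-! ## Cutting one part with a multiway cut -/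

/-- Greedy balancing: objects of size at most `T` can be put into `b` bins such that no bin
exceeds the average load by more than `T`. -/
theorem exists_grouping {ι : Type*} [Fintype ι] (s : ι → ℕ) (T b : ℕ) (hb : 0 < b)
    (hs : ∀ i, s i ≤ T) :
    ∃ σ : ι → Fin b, ∀ j, b * (∑ i, if σ i = j then s i else 0) ≤ ∑ i, s i + b * T := by
  classical
  suffices h : ∀ t : Finset ι, ∃ σ : ι → Fin b, ∀ j,
      b * (∑ i ∈ t, if σ i = j then s i else 0) ≤ ∑ i ∈ t, s i + b * T from h Finset.univ
  intro t
  induction t using Finset.induction_on with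
  | empty => exact ⟨fun _ => ⟨0, hb⟩, by simp⟩
  | insert x t hx ih =>
    obtain ⟨σ, hσ⟩ := ih
    obtain ⟨j₀, h₀⟩ : ∃ j₀ : Fin b, b * (∑ i ∈ t, if σ i = j₀ then s i else 0) ≤ ∑ i ∈ t, s i := by
      by_contra! hlt
      have h1 : ∑ j : Fin b, ∑ i ∈ t, s i <
          ∑ j : Fin b, b * (∑ i ∈ t, if σ i = j then s i else 0) :=
        Finset.sum_lt_sum_of_nonempty ⟨⟨0, hb⟩, Finset.mem_univ _⟩ fun j _ => hlt j
      have h2 : ∑ j : Fin b, ∑ i ∈ t, (if σ i = j then s i else 0) = ∑ i ∈ t, s i := by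
        rw [Finset.sum_comm]; simp
      rw [← Finset.mul_sum, h2] at h1
      simp at h1
    have h2 : ∀ j, (∑ i ∈ t, if Function.update σ x j₀ i = j then s i else 0) =
        ∑ i ∈ t, if σ i = j then s i else 0 := fun j =>
      Finset.sum_congr rfl fun i hi => by
        rw [Function.update_of_ne (ne_of_mem_of_not_mem hi hx)]
    refine ⟨Function.update σ x j₀, fun j => ?_⟩
    rw [Finset.sum_insert hx, Finset.sum_insert hx, h2, Function.update_self]
    by_cases hj : j₀ = j
    · subst hj
      have := Nat.mul_le_mul_left b (hs x)
      simp only [if_true, mul_add]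
      omega
    · have := hσ j
      simp only [hj, if_false, zero_add]
      omega

/-- The number of vertices with label `ℓ`. -/
def partSize (n : ℕ) (L : ℕ → ℕ) (ℓ : ℕ) : ℕ := ∑ v ∈ Finset.range n, if L v = ℓ then 1 else 0

/-- The number of vertices of part `ℓ` that lie in piece `i`. -/
def pieceSize (n : ℕ) (L : ℕ → ℕ) (ℓ : ℕ) (p : ℕ → ℕ) (i : ℕ) : ℕ :=
  ∑ v ∈ Finset.range n, if L v = ℓ ∧ p v = i then 1 else 0

/-- Twice the weight of the edges between vertices with different labels. -/
def doubleCut (n : ℕ) (W : ℕ → ℕ → ℕ) (L : ℕ → ℕ) : ℕ :=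
  ∑ u ∈ Finset.range n, ∑ v ∈ Finset.range n, if L u ≠ L v then W u v else 0

/-- The weight of the edges inside part `ℓ` that leave piece `i`. -/
def pieceCut (n : ℕ) (W : ℕ → ℕ → ℕ) (L : ℕ → ℕ) (ℓ : ℕ) (p : ℕ → ℕ) (i : ℕ) : ℕ :=
  ∑ u ∈ Finset.range n, ∑ v ∈ Finset.range n,
    if p u = i then if p v ≠ i then if L u = ℓ ∧ L v = ℓ then W u v else 0 else 0 else 0

/-- The weights of the multiway cut instance for part `ℓ`: the first `a` vertices are terminals,
each of them joined to all vertices of the part by edges of weight `ω`. -/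
def auxWeight (a : ℕ) (W : ℕ → ℕ → ℕ) (L : ℕ → ℕ) (ℓ ω i j : ℕ) : ℕ :=
  if i < a then
    if j < a then 0 else if L (j - a) = ℓ then ω else 0
  else
    if j < a then if L (i - a) = ℓ then ω else 0
    else if L (i - a) = ℓ ∧ L (j - a) = ℓ then W (i - a) (j - a) else 0

/-- The graph with the weights `auxWeight`. -/
def auxGraph (a n : ℕ) (W : ℕ → ℕ → ℕ) (hW : ∀ u v, W u v = W v u) (hW' : ∀ v, W v v = 0)
    (L : ℕ → ℕ) (ℓ ω : ℕ) : WeightedGraph (a + n) where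
  weight i j := (auxWeight a W L ℓ ω i j : ℚ≥0)
  symm i j := by
    unfold auxWeight
    rw [hW]
    simp only [and_comm]
    split_ifs <;> rfl
  loopless i := by
    simp only [auxWeight, hW']
    split_ifs <;> simp

/-- The multiway cut instance for part `ℓ`. -/
def auxInstance (a n : ℕ) (W : ℕ → ℕ → ℕ) (hW : ∀ u v, W u v = W v u) (hW' : ∀ v, W v v = 0)
    (L : ℕ → ℕ) (ℓ ω : ℕ) : MultiwayInstance a where
  n := a + n
  graph := auxGraph a n W hW hW' L ℓ ω
  terminal := Fin.castAddEmb n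

theorem auxInstance_feasible_iff {a n : ℕ} {W : ℕ → ℕ → ℕ} {hW : ∀ u v, W u v = W v u}
    {hW' : ∀ v, W v v = 0} {L : ℕ → ℕ} {ℓ ω : ℕ} (P : Labelling (a + n) a) :
    (auxInstance a n W hW hW' L ℓ ω).Feasible P ↔ ∀ i, ∃! j, P (Fin.castAdd n j) = i := by
  refine forall_congr' fun i => existsUnique_congr fun j => ?_
  exact Finset.mem_filter_univ (Fin.castAdd n j)

section

variable {c n : ℕ} {W : ℕ → ℕ → ℕ} {hW : ∀ u v, W u v = W v u} {hW' : ∀ v, W v v = 0}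
  {L : ℕ → ℕ} {ℓ ω : ℕ}

theorem WeightedGraph.boundary_part {n k : ℕ} (G : WeightedGraph n) (P : Labelling n k) (i : Fin k) :
    G.boundary (P.part i) = ∑ u, if P u = i then ∑ v, if P v ≠ i then G.weight u v else 0 else 0 := by
  simp only [WeightedGraph.boundary, Labelling.part, Finset.compl_filter, Finset.sum_filter]

/-- With m and s the sizes of the part and of the piece, the terminal in the piece loses its edges
to the m − s other vertices of the part, and each of the s vertices loses its edges to the other c +
1 terminals. The sum is ω(m + cs), so large pieces are penalized. -/
theorem boundary_auxInstance (P : Labelling (c + 2 + n) (c + 2))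
    (hP : ∀ i, ∃! j, P (Fin.castAdd n j) = i) (p : ℕ → ℕ)
    (hp : ∀ v : Fin n, (P (Fin.natAdd (c + 2) v) : ℕ) = p v) (i : Fin (c + 2)) :
    (auxGraph (c + 2) n W hW hW' L ℓ ω).boundary (P.part i) =
      ((ω * (partSize n L ℓ + c * pieceSize n L ℓ p i) + pieceCut n W L ℓ p i : ℕ) : ℚ≥0) := by
  obtain ⟨j₀, h1, h2⟩ := hP i
  have hj : ∀ j, P (Fin.castAdd n j) = i ↔ j = j₀ := fun j => ⟨h2 j, fun h => h ▸ h1⟩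
  have hp' : ∀ v : Fin n, P (Fin.natAdd (c + 2) v) = i ↔ p v = i := fun v => by
    rw [← hp, Fin.ext_iff]
  have key : (auxGraph (c + 2) n W hW hW' L ℓ ω).boundary (P.part i) =
      ((∑ u : Fin (c + 2 + n), if P u = i then ∑ v : Fin (c + 2 + n),
        if P v ≠ i then auxWeight (c + 2) W L ℓ ω u v else 0 else 0 : ℕ) : ℚ≥0) := by
    refine (WeightedGraph.boundary_part _ P i).trans ?_
    push_cast
    rfl
  rw [key]
  congr 1
  -- Exactly c + 1 terminals lie outside the piece.
  have e1 : ∀ X : ℕ, (∑ j : Fin (c + 2), if ¬ j = j₀ then X else 0) = (c + 1) * X := by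
    intro X
    rw [← Finset.sum_filter, Finset.sum_const, Finset.filter_ne', Finset.card_erase_of_mem (Finset.mem_univ _)]
    simp
  have hsum : ∀ F : Fin (c + 2 + n) → ℕ, ∑ u, F u =
      ∑ j, F (Fin.castAdd n j) + ∑ v, F (Fin.natAdd (c + 2) v) := Fin.sum_univ_add
  simp only [hsum, hj, hp', ne_eq]
  simp only [auxWeight, Fin.val_castAdd, Fin.val_natAdd, Fin.is_lt, if_true, Nat.not_lt.2 (Nat.le_add_right _ _),
    if_false, Nat.add_sub_cancel_left, Finset.sum_ite_eq', Finset.mem_univ, e1]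
  rw [mul_zero, zero_add, Fin.sum_univ_eq_sum_range (fun v => if ¬ p v = (i : ℕ) then if L v = ℓ then ω else 0 else 0)]
  have hin : ∀ u : ℕ, (∑ v : Fin n, if ¬ p v = (i : ℕ) then if L u = ℓ ∧ L v = ℓ then W u v else 0 else 0) =
      ∑ v ∈ Finset.range n, if ¬ p v = (i : ℕ) then if L u = ℓ ∧ L v = ℓ then W u v else 0 else 0 := fun u =>
    Fin.sum_univ_eq_sum_range (fun v => if ¬ p v = (i : ℕ) then if L u = ℓ ∧ L v = ℓ then W u v else 0 else 0) n
  simp only [hin]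
  rw [Fin.sum_univ_eq_sum_range (fun u => if p u = (i : ℕ) then (c + 1) * (if L u = ℓ then ω else 0) +
    ∑ v ∈ Finset.range n, (if ¬ p v = (i : ℕ) then if L u = ℓ ∧ L v = ℓ then W u v else 0 else 0) else 0)]
  have e2 : (∑ v ∈ Finset.range n, if ¬ p v = (i : ℕ) then if L v = ℓ then ω else 0 else 0) +
      ω * pieceSize n L ℓ p i = ω * partSize n L ℓ := by
    simp only [pieceSize, partSize, Finset.mul_sum, ← Finset.sum_add_distrib]
    refine Finset.sum_congr rfl fun v _ => ?_
    by_cases h3 : p v = i <;> by_cases h4 : L v = ℓ <;> simp [h3, h4]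
  have e3 : (∑ u ∈ Finset.range n, if p u = (i : ℕ) then (c + 1) * (if L u = ℓ then ω else 0) +
    ∑ v ∈ Finset.range n, (if ¬ p v = (i : ℕ) then if L u = ℓ ∧ L v = ℓ then W u v else 0 else 0) else 0)
      = (c + 1) * (ω * pieceSize n L ℓ p i) + pieceCut n W L ℓ p i := by
    simp only [pieceSize, pieceCut, Finset.mul_sum, ← Finset.sum_add_distrib]
    refine Finset.sum_congr rfl fun v _ => ?_
    by_cases h3 : p v = i <;> by_cases h4 : L v = ℓ <;> simp [h3, h4]
  rw [e3, mul_add, ← e2]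
  ring

/-- An edge leaving a piece joins different classes of the finer partition `q`, and `doubleCut`
counts it in both orientations. -/
theorem two_mul_pieceCut_le (hW : ∀ u v, W u v = W v u) (p q : ℕ → ℕ)
    (hpq : ∀ u v, p u ≠ p v → q u ≠ q v) (i : ℕ) :
    2 * pieceCut n W L ℓ p i ≤ doubleCut n W q := by
  rw [two_mul]
  nth_rw 2 [pieceCut]
  rw [Finset.sum_comm]
  simp only [pieceCut, doubleCut, ← Finset.sum_add_distrib]
  refine Finset.sum_le_sum fun u _ => Finset.sum_le_sum fun v _ => ?_
  by_cases h1 : p u = i <;> by_cases h2 : p v = i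
  · simp [h1, h2]
  · have := hpq u v (by rw [h1]; exact Ne.symm h2)
    simp only [h1, h2, this, ne_eq, not_true, not_false_eq_true, if_true, if_false]
    split_ifs <;> simp
  · have := hpq u v (by rw [h2]; exact h1)
    simp only [h1, h2, this, ne_eq, not_true, not_false_eq_true, if_true, if_false]
    rw [hW u v]
    split_ifs <;> simp
  · simp [h1, h2]

theorem sum_pieceSize (p : ℕ → ℕ) (b : ℕ) (hp : ∀ v < n, p v < b) :
    ∑ i ∈ Finset.range b, pieceSize n L ℓ p i = partSize n L ℓ := by
  unfold pieceSize partSize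
  rw [Finset.sum_comm]
  refine Finset.sum_congr rfl fun v hv => ?_
  by_cases h : L v = ℓ
  · simp [h, hp v (by simpa using hv)]
  · simp [h]

/-- An approximately optimal multiway cut of the auxiliary instance, compared with a partition
`q` into `k` small parts. -/
theorem pieces_le {k : ℕ} (hbig : c * n < partSize n L ℓ * k)
    (P : Labelling (c + 2 + n) (c + 2))
    (hP : ∀ i, ∃! j, P (Fin.castAdd n j) = i)
    (hapx : ∀ Q : Labelling (c + 2 + n) (c + 2), (∀ i, ∃! j, Q (Fin.castAdd n j) = i) →
      9 * (auxGraph (c + 2) n W hW hW' L ℓ ω).maxBoundary P ≤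
        (c + 2 : ℕ) * (auxGraph (c + 2) n W hW hW' L ℓ ω).maxBoundary Q)
    (p : ℕ → ℕ) (hp : ∀ v : Fin n, (P (Fin.natAdd (c + 2) v) : ℕ) = p v)
    (q : ℕ → ℕ) (hq : ∀ v < n, q v < k) (hq' : ∀ i, k * partSize n q i ≤ n) (i : ℕ) (hi : i < c + 2) :
    18 * (ω * (partSize n L ℓ + c * pieceSize n L ℓ p i) + pieceCut n W L ℓ p i) ≤
      (c + 2) * (6 * (ω * partSize n L ℓ) + doubleCut n W q) := by
  set m := partSize n L ℓ with hm
  have hps : ∀ i, k * pieceSize n L ℓ q i ≤ n := fun i => by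
    refine (Nat.mul_le_mul_left k ?_).trans (hq' i)
    refine Finset.sum_le_sum fun v _ => ?_
    split_ifs <;> simp_all
  obtain ⟨σ, hσ⟩ := exists_grouping (fun i : Fin k => k * pieceSize n L ℓ q i) n (c + 2) (by omega)
    (fun i => hps i)
  -- The comparison solution: the parts of `q` are grouped into c + 2 bins, and terminal j joins bin
  -- j. The default 0 is never used, because labels of vertices are below `k`.
  let σ' : ℕ → Fin (c + 2) := fun x => if h : x < k then σ ⟨x, h⟩ else 0
  let Q : Labelling (c + 2 + n) (c + 2) := Fin.addCases (fun j => j) (fun v => σ' (q v))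
  have hQ : ∀ i, ∃! j, Q (Fin.castAdd n j) = i := fun i => by simp [Q]
  have hsz : ∀ j : Fin (c + 2), (c + 2) * (k * pieceSize n L ℓ (fun v => σ' (q v)) j) ≤
      k * m + (c + 2) * n := by
    intro j
    refine le_trans (le_of_eq ?_) ((hσ j).trans (le_of_eq ?_))
    · congr 1
      have h1 : pieceSize n L ℓ (fun v => (σ' (q v) : ℕ)) j =
          ∑ i : Fin k, if σ i = j then pieceSize n L ℓ q i else 0 := by
        have h2 : ∀ i : Fin k, (if σ i = j then pieceSize n L ℓ q i else 0) =
            (fun x : ℕ => if σ' x = j then pieceSize n L ℓ q x else 0) i := fun i => by simp [σ']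
        simp only [h2]
        rw [Fin.sum_univ_eq_sum_range (fun x : ℕ => if σ' x = j then pieceSize n L ℓ q x else 0)]
        simp only [pieceSize, ← Finset.sum_filter (p := fun x => σ' x = j)]
        rw [Finset.sum_comm]
        refine Finset.sum_congr rfl fun v hv => ?_
        have h3 := hq v (by simpa using hv)
        by_cases h4 : L v = ℓ
        · simp only [h4, true_and, Finset.sum_ite_eq, Finset.mem_filter, Finset.mem_range, h3, Fin.ext_iff]
        · simp [h4]
      rw [h1, Finset.mul_sum]
      exact Finset.sum_congr rfl fun i _ => by split_ifs <;> simp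
    · rw [← Finset.mul_sum, Fin.sum_univ_eq_sum_range (fun x : ℕ => pieceSize n L ℓ q x),
        sum_pieceSize q k hq]
  have hk : 0 < k := Nat.pos_of_ne_zero fun h => by simp [h] at hbig
  -- A bin holds at most m/(c + 2) + n/k vertices of the part, and cn/k < m because the part is
  -- large.
  have hc : ∀ j : Fin (c + 2), c * pieceSize n L ℓ (fun v => σ' (q v)) j ≤ 2 * m := by
    intro j
    have h1 := hsz j
    have h2 : k * ((c + 2) * (c * pieceSize n L ℓ (fun v => σ' (q v)) j)) ≤ k * ((c + 2) * (2 * m)) := by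
      nlinarith [Nat.mul_le_mul_left c h1]
    exact Nat.le_of_mul_le_mul_left (Nat.le_of_mul_le_mul_left h2 hk) (by omega)
  -- Each boundary is at most ω(m + 2m) plus half of `doubleCut`.
  have hmax : 2 * (auxGraph (c + 2) n W hW hW' L ℓ ω).maxBoundary Q ≤
      ((6 * (ω * m) + doubleCut n W q : ℕ) : ℚ≥0) := by
    rw [mul_comm, ← le_div_iff₀ (by norm_num)]
    refine Finset.sup_le fun j _ => ?_
    rw [le_div_iff₀ (by norm_num), mul_comm, boundary_auxInstance Q hQ (fun v => σ' (q v)) (fun v => by simp [Q]) j]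
    norm_cast
    have h1 := hc j
    have h2 := two_mul_pieceCut_le (n := n) (L := L) (ℓ := ℓ) hW (fun v => (σ' (q v) : ℕ)) q
      (fun u v h1 h2 => h1 (by simp only [h2])) j
    nlinarith [Nat.mul_le_mul_left ω h1]
  have h1 := hapx Q hQ
  have h2 : (auxGraph (c + 2) n W hW hW' L ℓ ω).boundary (P.part ⟨i, hi⟩) ≤
      (auxGraph (c + 2) n W hW hW' L ℓ ω).maxBoundary P :=
    Finset.le_sup (f := fun i => (auxGraph (c + 2) n W hW hW' L ℓ ω).boundary (P.part i)) (Finset.mem_univ _)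
  rw [boundary_auxInstance P hP p hp ⟨i, hi⟩] at h2
  have h3 : (18 : ℚ≥0) * ((ω * (partSize n L ℓ + c * pieceSize n L ℓ p i) + pieceCut n W L ℓ p i : ℕ) : ℚ≥0) ≤
      (c + 2 : ℕ) * ((6 * (ω * m) + doubleCut n W q : ℕ) : ℚ≥0) := by
    calc _ ≤ 2 * (9 * (auxGraph (c + 2) n W hW hW' L ℓ ω).maxBoundary P) := by
          rw [← mul_assoc]
          norm_num
          simpa using h2
      _ ≤ 2 * ((c + 2 : ℕ) * (auxGraph (c + 2) n W hW hW' L ℓ ω).maxBoundary Q) := by gcongr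
      _ = (c + 2 : ℕ) * (2 * (auxGraph (c + 2) n W hW hW' L ℓ ω).maxBoundary Q) := by ring
      _ ≤ _ := by gcongr
  exact_mod_cast h3

end

/-! ## The splitting procedure -/

/-- A loopless weighted graph on `{0, …, n - 1}` with natural weights. -/
structure NatGraph where
  n : ℕ
  W : ℕ → ℕ → ℕ
  symm : ∀ u v, W u v = W v u
  loopless : ∀ v, W v v = 0

/-- `q` splits the vertices into `k` parts of size at most `n / k`. -/
def NatGraph.EqualParts (Γ : NatGraph) (k : ℕ) (q : ℕ → ℕ) : Prop :=
  (∀ v < Γ.n, q v < k) ∧ ∀ i, k * partSize Γ.n q i ≤ Γ.n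

/-- The specification of the approximation algorithm for multiway cuts. -/
def IsMultiwayOracle (c : ℕ) (F : (J : MultiwayInstance (c + 2)) → Labelling J.n (c + 2)) : Prop :=
  ∀ J : MultiwayInstance (c + 2), J.Feasible (F J) ∧ ∀ Q, J.Feasible Q →
    9 * J.graph.maxBoundary (F J) ≤ (c + 2 : ℕ) * J.graph.maxBoundary Q

section

variable {c : ℕ} (F : (J : MultiwayInstance (c + 2)) → Labelling J.n (c + 2)) (Γ : NatGraph)
  (L : ℕ → ℕ) (ℓ ω : ℕ)

/-- The piece that the multiway cut algorithm assigns to the vertex `v`. -/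
def pieceLabel (v : ℕ) : ℕ :=
  if h : c + 2 + v < c + 2 + Γ.n then
    (F (auxInstance (c + 2) Γ.n Γ.W Γ.symm Γ.loopless L ℓ ω) ⟨c + 2 + v, h⟩ : ℕ)
  else 0

/-- An upper bound for the weight of all cuts. -/
def NatGraph.total : ℕ := 1 + ∑ u ∈ Finset.range Γ.n, ∑ v ∈ Finset.range Γ.n, Γ.W u v

/-- Some piece has more than half of the vertices of part `ℓ`. -/
def Unbalanced : Prop :=
  ∃ i < c + 2, partSize Γ.n L ℓ < 2 * pieceSize Γ.n L ℓ (pieceLabel F Γ L ℓ ω) i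

/-- The terminal weight that is used for splitting part `ℓ`. -/
noncomputable def splitWeight : ℕ := 2 ^ searchExp (Unbalanced F Γ L ℓ) Γ.total

/-- The pieces into which part `ℓ` is split. -/
noncomputable def splitLabel (v : ℕ) : ℕ := pieceLabel F Γ L ℓ (splitWeight F Γ L ℓ) v

/-- Split part `ℓ` of a labelling with labels below `S.2` if it is too large. -/
noncomputable def splitStep (k : ℕ) (S : (ℕ → ℕ) × ℕ) : (ℕ → ℕ) × ℕ :=
  (fun v => if c * Γ.n < partSize Γ.n S.1 ℓ * k ∧ S.1 v = ℓ then S.2 + splitLabel F Γ S.1 ℓ v else S.1 v,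
    if c * Γ.n < partSize Γ.n S.1 ℓ * k then S.2 + (c + 2) else S.2)

/-- Process the parts `0, …, ℓ - 1` one after the other. -/
noncomputable def splitIter (k : ℕ) : ℕ → (ℕ → ℕ) × ℕ
  | 0 => (fun _ => 0, 1)
  | ℓ + 1 => splitStep F Γ ℓ k (splitIter k ℓ)

variable {F Γ L ℓ ω}

theorem pieceLabel_lt (v : ℕ) : pieceLabel F Γ L ℓ ω v < c + 2 := by
  unfold pieceLabel
  split_ifs
  · exact Fin.is_lt _
  · omega

theorem pieceLabel_le (hF : IsMultiwayOracle c F) {k : ℕ} (hbig : c * Γ.n < partSize Γ.n L ℓ * k)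
    {q : ℕ → ℕ} (hq : Γ.EqualParts k q) {i : ℕ} (hi : i < c + 2) :
    18 * (ω * (partSize Γ.n L ℓ + c * pieceSize Γ.n L ℓ (pieceLabel F Γ L ℓ ω) i) +
      pieceCut Γ.n Γ.W L ℓ (pieceLabel F Γ L ℓ ω) i) ≤
      (c + 2) * (6 * (ω * partSize Γ.n L ℓ) + doubleCut Γ.n Γ.W q) := by
  obtain ⟨h1, h2⟩ := hF (auxInstance (c + 2) Γ.n Γ.W Γ.symm Γ.loopless L ℓ ω)
  refine pieces_le (hW := Γ.symm) (hW' := Γ.loopless) hbig _ ((auxInstance_feasible_iff _).1 h1)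
    (fun Q hQ => h2 Q ((auxInstance_feasible_iff _).2 hQ)) _ (fun v => ?_) q hq.1 hq.2 i hi
  rw [pieceLabel, dif_pos (by omega)]
  rfl

/-- Here the ratio b/9 is used: `pieceLabel_le` gives 18(m + cs) ≤ 8(c + 2)m, whereas 2s > m would
make the left side exceed (18 + 9c)m. -/
theorem balanced (hc : 1 ≤ c) (hF : IsMultiwayOracle c F) {k : ℕ}
    (hbig : c * Γ.n < partSize Γ.n L ℓ * k) {q : ℕ → ℕ} (hq : Γ.EqualParts k q) (hω : 0 < ω)
    (h : doubleCut Γ.n Γ.W q ≤ 2 * (ω * partSize Γ.n L ℓ)) : ¬ Unbalanced F Γ L ℓ ω := by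
  rintro ⟨i, hi, h1⟩
  have h2 := pieceLabel_le (ω := ω) hF hbig hq hi
  set m := partSize Γ.n L ℓ
  set s := pieceSize Γ.n L ℓ (pieceLabel F Γ L ℓ ω) i
  have h3 : ω * (18 * (m + c * s)) ≤ ω * (8 * ((c + 2) * m)) := by
    have := Nat.mul_le_mul_left (c + 2) h
    nlinarith
  have h4 := Nat.le_of_mul_le_mul_left h3 hω
  nlinarith [Nat.mul_le_mul_left c h1.le]

theorem doubleCut_lt_total (q : ℕ → ℕ) : doubleCut Γ.n Γ.W q < Γ.total := by
  unfold doubleCut NatGraph.total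
  rw [Nat.lt_one_add_iff]
  refine Finset.sum_le_sum fun u _ => Finset.sum_le_sum fun v _ => ?_
  split_ifs <;> simp

/-- The search ends either at a balanced ω or at one beyond the total weight, where `balanced`
applies anyway. -/
theorem splitLabel_balanced (hc : 1 ≤ c) (hF : IsMultiwayOracle c F) {k : ℕ}
    (hbig : c * Γ.n < partSize Γ.n L ℓ * k) {q : ℕ → ℕ} (hq : Γ.EqualParts k q) {i : ℕ}
    (hi : i < c + 2) :
    2 * pieceSize Γ.n L ℓ (splitLabel F Γ L ℓ) i ≤ partSize Γ.n L ℓ := by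
  have h1 : ¬ Unbalanced F Γ L ℓ (splitWeight F Γ L ℓ) := by
    rcases not_and_or.1 (searchExp_spec (Unbalanced F Γ L ℓ) Γ.total) with h | h
    · exact h
    · have hm : 0 < partSize Γ.n L ℓ := Nat.pos_of_ne_zero fun h => by simp [h] at hbig
      refine balanced hc hF hbig hq (pow_pos (by norm_num) _) ?_
      have h3 := doubleCut_lt_total (Γ := Γ) q
      have h4 : splitWeight F Γ L ℓ ≤ splitWeight F Γ L ℓ * partSize Γ.n L ℓ :=
        Nat.le_mul_of_pos_right _ hm
      have h5 : Γ.total ≤ splitWeight F Γ L ℓ := not_lt.1 h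
      omega
  by_contra h
  exact h1 ⟨i, hi, not_le.1 h⟩

theorem dvd_pieceCut {M : ℕ} (hM : ∀ u v, M ∣ Γ.W u v) (p : ℕ → ℕ) (i : ℕ) :
    M ∣ pieceCut Γ.n Γ.W L ℓ p i :=
  Finset.dvd_sum fun u _ => Finset.dvd_sum fun v _ => by split_ifs <;> simp [hM]

theorem dvd_doubleCut {M : ℕ} (hM : ∀ u v, M ∣ Γ.W u v) (q : ℕ → ℕ) : M ∣ doubleCut Γ.n Γ.W q :=
  Finset.dvd_sum fun u _ => Finset.dvd_sum fun v _ => by split_ifs <;> simp [hM]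

theorem partSize_le (n : ℕ) : partSize n L ℓ ≤ n := by
  unfold partSize
  calc _ ≤ ∑ v ∈ Finset.range n, 1 := Finset.sum_le_sum fun v _ => by split_ifs <;> simp
    _ = n := by simp

/-- Minimality of ω gives ωm ≤ O, so each of the c + 2 pieces cuts at most 7(c + 2)O/18.
Divisibility by the large `M` covers the case ω = 1, where no smaller weight was tried. -/
theorem splitLabel_cut (hc : 1 ≤ c) (hF : IsMultiwayOracle c F) {M : ℕ} (hM : ∀ u v, M ∣ Γ.W u v)
    (hM' : (c + 2) * (c + 2) * Γ.n < M) {k : ℕ}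
    (hbig : c * Γ.n < partSize Γ.n L ℓ * k) {q : ℕ → ℕ} (hq : Γ.EqualParts k q) :
    18 * ∑ i ∈ Finset.range (c + 2), pieceCut Γ.n Γ.W L ℓ (splitLabel F Γ L ℓ) i ≤
      7 * (c + 2) ^ 2 * doubleCut Γ.n Γ.W q := by
  set m := partSize Γ.n L ℓ with hm
  set O := doubleCut Γ.n Γ.W q with hO
  set C := ∑ i ∈ Finset.range (c + 2), pieceCut Γ.n Γ.W L ℓ (splitLabel F Γ L ℓ) i with hC
  have hsum : 18 * C ≤ (c + 2) * ((c + 2) * (6 * (splitWeight F Γ L ℓ * m) + O)) := by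
    rw [hC, Finset.mul_sum]
    calc _ ≤ ∑ i ∈ Finset.range (c + 2), ((c + 2) * (6 * (splitWeight F Γ L ℓ * m) + O)) := by
          refine Finset.sum_le_sum fun i hi => ?_
          have := pieceLabel_le (ω := splitWeight F Γ L ℓ) hF hbig hq (Finset.mem_range.1 hi)
          refine le_trans ?_ this
          exact Nat.mul_le_mul_left _ (Nat.le_add_left _ _)
      _ = _ := by simp
  have hfin : splitWeight F Γ L ℓ * m ≤ O → 18 * C ≤ 7 * (c + 2) ^ 2 * O := fun h => by
    calc _ ≤ _ := hsum
      _ ≤ (c + 2) * ((c + 2) * (6 * O + O)) := by gcongr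
      _ = _ := by ring
  rcases Nat.eq_zero_or_pos (searchExp (Unbalanced F Γ L ℓ) Γ.total) with h0 | h0
  · have h1 : splitWeight F Γ L ℓ = 1 := by simp [splitWeight, h0]
    have hmn : m ≤ Γ.n := partSize_le _
    rcases Nat.eq_zero_or_pos O with hO0 | hO0
    -- If the optimum is 0, then C is a multiple of `M` that is smaller than `M`, hence 0.
    · have hMC : M ∣ C := Finset.dvd_sum fun i _ => dvd_pieceCut hM _ _
      have : C < M := by
        rw [h1, hO0] at hsum
        have := Nat.mul_le_mul_left ((c + 2) * (c + 2)) hmn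
        nlinarith
      rw [Nat.eq_zero_of_dvd_of_lt hMC this]
      simp
    · refine hfin ?_
      have h2 : M ≤ O := Nat.le_of_dvd hO0 (dvd_doubleCut hM q)
      have h3 : Γ.n ≤ (c + 2) * (c + 2) * Γ.n := Nat.le_mul_of_pos_left _ (by positivity)
      rw [h1]
      omega
  · refine hfin ?_
    -- The weight ω/2 was still unbalanced, so `balanced` fails for it, which means ωm < O.
    have h1 := (searchExp_min (Unbalanced F Γ L ℓ) Γ.total (i := searchExp (Unbalanced F Γ L ℓ) Γ.total - 1)
      (by omega)).1
    have h2 : ¬ (O ≤ 2 * (2 ^ (searchExp (Unbalanced F Γ L ℓ) Γ.total - 1) * m)) := fun h =>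
      balanced hc hF hbig hq (pow_pos (by norm_num) _) h h1
    have h3 : splitWeight F Γ L ℓ = 2 * 2 ^ (searchExp (Unbalanced F Γ L ℓ) Γ.total - 1) := by
      rw [splitWeight, ← pow_succ']
      congr 1
      omega
    rw [h3, mul_assoc]
    omega

/-! ### The invariant -/

/-- The invariant before part `ℓ` is processed; `r` counts the splits. -/
structure SplitInv (Γ : NatGraph) (c k ℓ : ℕ) (S : (ℕ → ℕ) × ℕ) (r : ℕ) : Prop where
  count : S.2 = 1 + (c + 2) * r
  lt : ∀ v < Γ.n, S.1 v < S.2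
  small : ∀ i < ℓ, partSize Γ.n S.1 i * k ≤ c * Γ.n
  -- Truncated subtraction makes parts of at most cn/(2k) vertices free, so empty and tiny pieces do
  -- no harm.
  potential : r * (c * Γ.n) + ∑ i ∈ Finset.range S.2, (2 * (k * partSize Γ.n S.1 i) - c * Γ.n) ≤
    2 * (k * Γ.n)
  cut : ∀ q, Γ.EqualParts k q →
    18 * doubleCut Γ.n Γ.W S.1 ≤ r * (7 * (c + 2) ^ 2 * doubleCut Γ.n Γ.W q)

theorem splitInv_zero (k : ℕ) : SplitInv Γ c k 0 (fun _ => 0, 1) 0 where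
  count := by simp
  lt := by simp
  small := by simp
  potential := by simp [partSize]
  cut := by simp [doubleCut]

/-- The drop of the potential in one split. The convex function x ↦ max(0, 2kx − T) vanishes at 0,
so on [0, m/2] it lies below the chord of slope (2km − 2T)/m. Summing the chord over the pieces
gives 2km − 2T. -/
theorem sum_tsub_le {b m T : ℕ} (k : ℕ) (s : ℕ → ℕ) (hs : ∀ i < b, 2 * s i ≤ m)
    (hsum : ∑ i ∈ Finset.range b, s i = m) (hm : T < m * k) :
    ∑ i ∈ Finset.range b, (2 * (k * s i) - T) + T ≤ 2 * (k * m) - T := by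
  have hm0 : 0 < m := Nat.pos_of_ne_zero fun h => by simp [h] at hm
  have h1 : m * ∑ i ∈ Finset.range b, (2 * (k * s i) - T) ≤ m * (2 * (k * m) - 2 * T) := by
    calc _ ≤ ∑ i ∈ Finset.range b, s i * (2 * (k * m) - 2 * T) := by
          rw [Finset.mul_sum]
          refine Finset.sum_le_sum fun i hi => ?_
          have h2 := hs i (Finset.mem_range.1 hi)
          rw [Nat.mul_sub, Nat.mul_sub, Nat.sub_le_iff_le_add]
          have h3 : s i * (2 * T) ≤ s i * (2 * (k * m)) := Nat.mul_le_mul_left _ (by nlinarith)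
          have h4 : m * (2 * (k * s i)) = s i * (2 * (k * m)) := by ring
          have h5 : s i * (2 * T) ≤ m * T := by nlinarith
          omega
      _ = _ := by rw [← Finset.sum_mul, hsum]
  have h2 := Nat.le_of_mul_le_mul_left h1 hm0
  have h3 : m * k = k * m := mul_comm _ _
  omega

/-- The sum over all pieces counts each newly cut edge once from either end, in agreement with
`doubleCut`. -/
theorem doubleCut_split (L : ℕ → ℕ) (p : ℕ → ℕ) (b N : ℕ) (hp : ∀ v, p v < b) :
    doubleCut Γ.n Γ.W (fun v => if L v = ℓ then N + p v else L v) ≤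
      doubleCut Γ.n Γ.W L + ∑ i ∈ Finset.range b, pieceCut Γ.n Γ.W L ℓ p i := by
  have h1 : ∑ i ∈ Finset.range b, pieceCut Γ.n Γ.W L ℓ p i =
      ∑ u ∈ Finset.range Γ.n, ∑ v ∈ Finset.range Γ.n,
        if p v ≠ p u then if L u = ℓ ∧ L v = ℓ then Γ.W u v else 0 else 0 := by
    unfold pieceCut
    rw [Finset.sum_comm]
    refine Finset.sum_congr rfl fun u _ => ?_
    rw [Finset.sum_comm]
    refine Finset.sum_congr rfl fun v _ => ?_
    simp [hp u]
  rw [h1]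
  simp only [doubleCut, ← Finset.sum_add_distrib]
  refine Finset.sum_le_sum fun u _ => Finset.sum_le_sum fun v _ => ?_
  by_cases h2 : L u = L v
  · by_cases h3 : L v = ℓ
    · by_cases h4 : p u = p v
      · simp [h2, h3, h4]
      · simp [h2, h3, h4, Ne.symm h4]
    · simp [h2, h3]
  · simp only [h2, ne_eq, not_false_eq_true, if_true]
    split_ifs <;> simp

theorem SplitInv.step (hc : 1 ≤ c) (hF : IsMultiwayOracle c F) {M : ℕ} (hM : ∀ u v, M ∣ Γ.W u v)
    (hM' : (c + 2) * (c + 2) * Γ.n < M) {k : ℕ} (hq : ∃ q, Γ.EqualParts k q)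
    {S : (ℕ → ℕ) × ℕ} {r : ℕ} (h : SplitInv Γ c k ℓ S r) :
    ∃ r', SplitInv Γ c k (ℓ + 1) (splitStep F Γ ℓ k S) r' := by
  obtain ⟨L, N⟩ := S
  obtain ⟨h1, h2, h3, h4, h5⟩ := h
  simp only at h1 h2 h3 h4 h5
  obtain ⟨q₀, hq₀⟩ := hq
  by_cases hbig : c * Γ.n < partSize Γ.n L ℓ * k
  swap
  · have e1 : splitStep F Γ ℓ k (L, N) = (L, N) := by simp [splitStep, hbig]
    rw [e1]
    refine ⟨r, h1, h2, fun i hi => ?_, h4, h5⟩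
    rcases Nat.lt_succ_iff_lt_or_eq.1 hi with hi | rfl
    · exact h3 i hi
    · exact not_lt.1 hbig
  set p := splitLabel F Γ L ℓ with hp
  have e1 : splitStep F Γ ℓ k (L, N) = (fun v => if L v = ℓ then N + p v else L v, N + (c + 2)) := by
    simp [splitStep, hbig, hp]
  rw [e1]
  set L' : ℕ → ℕ := fun v => if L v = ℓ then N + p v else L v with hL'
  have hpl : ∀ v, p v < c + 2 := fun v => pieceLabel_lt v
  have hlN : ℓ < N := by
    -- A large part is nonempty, so ℓ is a label in use. The fresh labels from N on therefore differ
    -- from ℓ, and the split leaves part ℓ empty.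
    have : 0 < partSize Γ.n L ℓ := Nat.pos_of_ne_zero fun h => by simp [h] at hbig
    obtain ⟨v, hv, hv'⟩ := Finset.exists_ne_zero_of_sum_ne_zero this.ne'
    have : L v = ℓ := by by_contra h; simp [h] at hv'
    exact this ▸ h2 v (Finset.mem_range.1 hv)
  have hsz1 : ∀ i < N, i ≠ ℓ → partSize Γ.n L' i = partSize Γ.n L i := fun i hi hil => by
    refine Finset.sum_congr rfl fun v _ => ?_
    by_cases h6 : L v = ℓ
    · have : N + p v ≠ i := by omega
      simp [hL', h6, this, hil.symm]
    · simp [hL', h6]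
  have hsz2 : partSize Γ.n L' ℓ = 0 := by
    refine Finset.sum_eq_zero fun v _ => ?_
    by_cases h6 : L v = ℓ
    · have : N + p v ≠ ℓ := by omega
      simp [hL', h6, this]
    · simp [hL', h6]
  have hsz3 : ∀ i, partSize Γ.n L' (N + i) = pieceSize Γ.n L ℓ p i := fun i => by
    refine Finset.sum_congr rfl fun v hv => ?_
    by_cases h6 : L v = ℓ
    · simp [hL', h6]
    · have : L v ≠ N + i := by have := h2 v (Finset.mem_range.1 hv); omega
      simp [hL', h6, this]
  refine ⟨r + 1, ?_, fun v hv => ?_, fun i hi => ?_, ?_, fun q hq => ?_⟩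
  · simp only [h1]; ring
  · have := h2 v hv
    have := hpl v
    simp only [hL']
    split_ifs <;> omega
  · rcases Nat.lt_succ_iff_lt_or_eq.1 hi with hi | rfl
    · simpa only [hsz1 i (by omega) hi.ne] using h3 i hi
    · simp [hsz2]
  · have h6 := sum_tsub_le k (fun i => pieceSize Γ.n L ℓ p i)
      (fun i hi => splitLabel_balanced hc hF hbig hq₀ hi) (sum_pieceSize p (c + 2) fun v _ => hpl v) hbig
    have hmem : ℓ ∈ Finset.range N := Finset.mem_range.2 hlN
    rw [← Finset.add_sum_erase _ _ hmem] at h4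
    simp only
    rw [Finset.sum_range_add, ← Finset.add_sum_erase _ _ hmem, hsz2]
    simp only [hsz3]
    rw [Finset.sum_congr rfl fun i hi => by
      rw [hsz1 i (Finset.mem_range.1 (Finset.mem_of_mem_erase hi)) (Finset.ne_of_mem_erase hi)]]
    rw [add_mul, one_mul]
    omega
  · have h6 := h5 q hq
    have h7 := splitLabel_cut hc hF hM hM' hbig hq
    have h8 : doubleCut Γ.n Γ.W L' ≤ _ := doubleCut_split (Γ := Γ) (ℓ := ℓ) L p (c + 2) N hpl
    rw [← hp] at h7
    simp only [add_mul, one_mul]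
    omega

theorem exists_splitInv (hc : 1 ≤ c) (hF : IsMultiwayOracle c F) {M : ℕ} (hM : ∀ u v, M ∣ Γ.W u v)
    (hM' : (c + 2) * (c + 2) * Γ.n < M) {k : ℕ} (hq : ∃ q, Γ.EqualParts k q) (ℓ : ℕ) :
    ∃ r, SplitInv Γ c k ℓ (splitIter F Γ k ℓ) r := by
  induction ℓ with
  | zero => exact ⟨0, splitInv_zero k⟩
  | succ ℓ ih =>
    obtain ⟨r, hr⟩ := ih
    exact hr.step hc hF hM hM' hq

/-- The labelling after all splits: few labels, small parts, small cut weight. -/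
theorem splitIter_spec (hc : 8 ≤ c) (hF : IsMultiwayOracle c F) {M : ℕ} (hM : ∀ u v, M ∣ Γ.W u v)
    (hM' : (c + 2) * (c + 2) * Γ.n < M) {k : ℕ} (hk : c + 2 ≤ k) (hq : ∃ q, Γ.EqualParts k q)
    {N : ℕ} (hN : N = 1 + (c + 2) * (2 * k)) :
    (∀ v < Γ.n, (splitIter F Γ k N).1 v < N) ∧
    (∀ i < N, k * partSize Γ.n (splitIter F Γ k N).1 i ≤ c * Γ.n) ∧
    ∀ q, Γ.EqualParts k q →
      doubleCut Γ.n Γ.W (splitIter F Γ k N).1 ≤ k ^ 2 * doubleCut Γ.n Γ.W q := by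
  obtain ⟨r, h1, h2, h3, h4, h5⟩ := exists_splitInv (Γ := Γ) (by omega : 1 ≤ c) hF hM hM' hq N
  -- A vertex is required because the potential bounds r only after division by n.
  have hr : ∀ v < Γ.n, r * c ≤ 2 * k := fun v hv => by
    have h6 : Γ.n * (r * c) ≤ Γ.n * (2 * k) := by
      calc Γ.n * (r * c) = r * (c * Γ.n) := by ring
        _ ≤ 2 * (k * Γ.n) := by omega
        _ = _ := by ring
    exact Nat.le_of_mul_le_mul_left h6 (by omega)
  refine ⟨fun v hv => (h2 v hv).trans_le ?_, fun i hi => by rw [mul_comm]; exact h3 i hi, fun q hq => ?_⟩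
  · have := hr v hv
    have h6 : r ≤ 2 * k := by nlinarith
    rw [h1, hN]
    gcongr
  · rcases Nat.eq_zero_or_pos Γ.n with h0 | h0
    · simp [doubleCut, h0]
    · have h6 := hr 0 h0
      have h7 := h5 q hq
      set O := doubleCut Γ.n Γ.W q
      -- Uses rc ≤ 2k, 7(c + 2) ≤ 9c (from c ≥ 8) and c + 2 ≤ k.
      have h8 : r * (7 * (c + 2) ^ 2) ≤ 18 * k ^ 2 := by
        have h9 : c * (r * (7 * (c + 2) ^ 2)) ≤ c * (18 * k ^ 2) := by
          calc c * (r * (7 * (c + 2) ^ 2)) = (r * c) * (7 * (c + 2) * (c + 2)) := by ring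
            _ ≤ (2 * k) * (9 * c * k) := by
              exact Nat.mul_le_mul h6 (Nat.mul_le_mul (by omega) hk)
            _ = _ := by ring
        exact Nat.le_of_mul_le_mul_left h9 (by omega)
      have h10 := Nat.mul_le_mul_right O h8
      nlinarith

end

/-! ## The splitting procedure runs in polynomial time -/

section

variable {X Y : Type} {e : X → Value} {e' : Y → Value}

theorem PolyN.app {L : X → ℕ → ℕ} (hL : PolyN (ext e) fun p => L p.1 p.2) {φ : Y → X}
    (hφ : PolyE e' fun y => e (φ y)) {m : Y → ℕ} (hm : PolyN e' m) :
    PolyN e' fun y => L (φ y) (m y) :=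
  (PolyE.pair hm hφ).comp (hL.comap fun y => (φ y, m y))

theorem PolyN.app₂ {W : X → ℕ → ℕ → ℕ} (hW : PolyN (ext (ext e)) fun p => W p.1.1 p.1.2 p.2)
    {φ : Y → X} (hφ : PolyE e' fun y => e (φ y)) {m m' : Y → ℕ} (hm : PolyN e' m)
    (hm' : PolyN e' m') : PolyN e' fun y => W (φ y) (m y) (m' y) :=
  (PolyE.pair hm' (PolyE.pair hm hφ)).comp (hW.comap fun y => ((φ y, m y), m' y))

theorem PolyE.weaken₁ : PolyE (ext e) fun p => e p.1 := PolyE.id.weaken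

theorem PolyE.weaken₂ : PolyE (ext (ext e)) fun p => e p.1.1 := PolyE.id.weaken.weaken

/-- A finite table. -/
theorem PolyN.table {f : X → ℕ} (hf : PolyN e f) (g : ℕ → ℕ) (N : ℕ) :
    PolyN e fun x => if f x < N then g (f x) else 0 := by
  induction N with
  | zero => simpa using PolyN.const 0
  | succ N ih =>
    convert PolyN.ite (PolyP.eq hf (.const N)) (.const (g N)) ih using 2 with x
    grind

theorem PolyN.partSize {n : X → ℕ} (hn : PolyN e n) (hnb : PolyBdd e n) {L : X → ℕ → ℕ}
    (hL : PolyN (ext e) fun p => L p.1 p.2) {ℓ : X → ℕ} (hℓ : PolyN e ℓ) :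
    PolyN e fun x => partSize (n x) (L x) (ℓ x) :=
  PolyN.sum hn hnb (.ite (.eq hL hℓ.weaken) (.const 1) (.const 0))

/-- The graph `Γ x` is computed from `e x` in polynomial time. -/
structure PolyGraph {X : Type} (e : X → Value) (Γ : X → NatGraph) : Prop where
  n : PolyN e fun x => (Γ x).n
  bdd : PolyBdd e fun x => (Γ x).n
  W : PolyN (ext (ext e)) fun p => (Γ p.1.1).W p.1.2 p.2

theorem PolyGraph.weaken {Γ : X → NatGraph} (h : PolyGraph e Γ) :
    PolyGraph (ext e) fun p => Γ p.1 where
  n := h.n.weaken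
  bdd := h.bdd.weaken
  W := PolyN.app₂ (W := fun x i j => (Γ x).W i j) (φ := fun p : ((X × ℕ) × ℕ) × ℕ => p.1.1.1) h.W (PolyE.weaken₁.weaken.weaken)
    PolyN.var.weaken PolyN.var

theorem PolyN.weakenFun {L : X → ℕ → ℕ} (hL : PolyN (ext e) fun p => L p.1 p.2) :
    PolyN (ext (ext e)) fun p => L p.1.1 p.2 :=
  PolyN.app (φ := fun p : (X × ℕ) × ℕ => p.1.1) hL PolyE.weaken₂ PolyN.var

theorem encRat_natCast (m : ℕ) : encRat (m : ℚ≥0) = .pair (.num m) (.num 1) := by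
  simp [encRat]

variable {Γ : X → NatGraph} {L : X → ℕ → ℕ} {ω : X → ℕ}

theorem PolyE.auxInstance (hΓ : PolyGraph e Γ) (hL : PolyN (ext e) fun p => L p.1 p.2)
    (hω : PolyN e ω) (ℓ a : ℕ) : PolyE e fun x =>
    (auxInstance a (Γ x).n (Γ x).W (Γ x).symm (Γ x).loopless (L x) ℓ (ω x)).enc := by
  have hi : PolyN (ext (ext e)) fun p => p.1.2 - a := PolyN.var.weaken.sub (.const a)
  have hj : PolyN (ext (ext e)) fun p => p.2 - a := PolyN.var.sub (.const a)
  have hω' : PolyN (ext (ext e)) fun p => ω p.1.1 := hω.weaken.weaken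
  have hLi : PolyP (ext (ext e)) fun p => L p.1.1 (p.1.2 - a) = ℓ :=
    .eq (PolyN.app (φ := fun p : (X × ℕ) × ℕ => p.1.1) hL PolyE.weaken₂ hi) (.const ℓ)
  have hLj : PolyP (ext (ext e)) fun p => L p.1.1 (p.2 - a) = ℓ :=
    .eq (PolyN.app (φ := fun p : (X × ℕ) × ℕ => p.1.1) hL PolyE.weaken₂ hj) (.const ℓ)
  have hia : PolyP (ext (ext e)) fun p => p.1.2 < a := .lt PolyN.var.weaken (.const a)
  have hja : PolyP (ext (ext e)) fun p => p.2 < a := .lt PolyN.var (.const a)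
  have hw : PolyN (ext (ext e)) fun p =>
      auxWeight a (Γ p.1.1).W (L p.1.1) ℓ (ω p.1.1) p.1.2 p.2 :=
    .ite hia (.ite hja (.const 0) (.ite hLj hω' (.const 0)))
      (.ite hja (.ite hLi hω' (.const 0)) (.ite (hLi.and hLj)
        (PolyN.app₂ (W := fun x i j => (Γ x).W i j) (φ := fun p : (X × ℕ) × ℕ => p.1.1) hΓ.W PolyE.weaken₂ hi hj) (.const 0)))
  have hN : PolyN e fun x => a + (Γ x).n := (PolyN.const a).add hΓ.n
  have hNb : PolyBdd e fun x => a + (Γ x).n := (PolyBdd.const a).add hΓ.bdd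
  have hr : PolyE (ext (ext e)) fun p =>
      encRat (auxWeight a (Γ p.1.1).W (L p.1.1) ℓ (ω p.1.1) p.1.2 p.2 : ℚ≥0) := by
    simp only [encRat_natCast]
    exact PolyE.pair hw (.const 1)
  exact PolyE.pair (PolyE.tabulate hN hNb (F := fun x i => encSeq fun j : Fin (a + (Γ x).n) =>
      encRat (auxWeight a (Γ x).W (L x) ℓ (ω x) i j : ℚ≥0))
      (PolyE.tabulate (n := fun p : X × ℕ => a + (Γ p.1).n) hN.weaken hNb.weaken
        (F := fun p j => encRat (auxWeight a (Γ p.1).W (L p.1) ℓ (ω p.1) p.2 j : ℚ≥0)) hr))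
    (PolyE.tabulate (n := fun _ => a) (.const a) (.const a) (F := fun _ i => .num i) PolyN.var)

variable {c : ℕ} {F : (J : MultiwayInstance (c + 2)) → Labelling J.n (c + 2)}

theorem PolyN.pieceLabel (hΓ : PolyGraph e Γ) (hL : PolyN (ext e) fun p => L p.1 p.2)
    (hω : PolyN e ω) (ℓ : ℕ)
    (hF : PolyE (fun J : MultiwayInstance (c + 2) => J.enc) fun J => (F J).enc) :
    PolyN (ext e) fun p => pieceLabel F (Γ p.1) (L p.1) ℓ (ω p.1) p.2 := by
  have h1 : PolyE e fun x => encList (List.ofFn fun v => .num (F (MinMaxCut.auxInstance (c + 2) (Γ x).n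
      (Γ x).W (Γ x).symm (Γ x).loopless (L x) ℓ (ω x)) v : ℕ)) :=
    (PolyE.auxInstance hΓ hL hω ℓ (c + 2)).comp (hF.comap fun x =>
      MinMaxCut.auxInstance (c + 2) (Γ x).n (Γ x).W (Γ x).symm (Γ x).loopless (L x) ℓ (ω x))
  have h2 := PolyE.getD (l := fun p : X × ℕ => List.ofFn fun v => .num (F (MinMaxCut.auxInstance (c + 2) (Γ p.1).n
      (Γ p.1).W (Γ p.1).symm (Γ p.1).loopless (L p.1) ℓ (ω p.1)) v : ℕ)) h1.weaken
    ((PolyN.const (c + 2)).add PolyN.var)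
  unfold PolyN
  convert h2 using 2 with p
  by_cases h : c + 2 + p.2 < c + 2 + (Γ p.1).n
  · rw [List.getD_eq_getElem _ _ (by rw [List.length_ofFn]; exact h)]
    simp only [MinMaxCut.pieceLabel, h, dif_pos, List.getElem_ofFn]
  · rw [List.getD_eq_default _ _ (by rw [List.length_ofFn]; exact not_lt.1 h)]
    simp only [MinMaxCut.pieceLabel, h, dif_neg, not_false_eq_true]

theorem PolyP.unbalanced (hΓ : PolyGraph e Γ) (hL : PolyN (ext e) fun p => L p.1 p.2)
    (hω : PolyN e ω) (ℓ : ℕ)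
    (hF : PolyE (fun J : MultiwayInstance (c + 2) => J.enc) fun J => (F J).enc) : PolyP e fun x => Unbalanced F (Γ x) (L x) ℓ (ω x) := by
  refine PolyP.exists_lt (n := fun _ => c + 2) (.const _) (.const _) (PolyP.lt ?_ (.mul (.const 2) ?_))
  · exact (PolyN.partSize hΓ.n hΓ.bdd hL (.const ℓ)).weaken
  · refine PolyN.sum hΓ.n.weaken hΓ.bdd.weaken (F := fun p v => if L p.1 v = ℓ ∧
      pieceLabel F (Γ p.1) (L p.1) ℓ (ω p.1) v = p.2 then 1 else 0) ?_
    exact .ite (.and (.eq hL.weakenFun (.const ℓ))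
      (.eq (PolyN.weakenFun (L := fun x v => MinMaxCut.pieceLabel F (Γ x) (L x) ℓ (ω x) v)
        (PolyN.pieceLabel hΓ hL hω ℓ hF)) PolyN.var.weaken)) (.const 1) (.const 0)

theorem PolyN.splitWeight (hΓ : PolyGraph e Γ) (hL : PolyN (ext e) fun p => L p.1 p.2) (ℓ : ℕ)
    (hF : PolyE (fun J : MultiwayInstance (c + 2) => J.enc) fun J => (F J).enc) : PolyN e fun x => splitWeight F (Γ x) (L x) ℓ := by
  refine PolyN.search ?_ ?_
  · refine (PolyN.const 1).add (PolyN.sum hΓ.n hΓ.bdd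
      (F := fun x u => ∑ v ∈ Finset.range (Γ x).n, (Γ x).W u v) ?_)
    exact PolyN.sum hΓ.n.weaken hΓ.bdd.weaken (F := fun p v => (Γ p.1).W p.2 v) hΓ.W
  · exact PolyP.unbalanced (L := fun p : X × ℕ => L p.1) hΓ.weaken hL.weakenFun PolyN.var ℓ hF

theorem PolyN.splitLabel (hΓ : PolyGraph e Γ) (hL : PolyN (ext e) fun p => L p.1 p.2) (ℓ : ℕ)
    (hF : PolyE (fun J : MultiwayInstance (c + 2) => J.enc) fun J => (F J).enc) : PolyN (ext e) fun p => splitLabel F (Γ p.1) (L p.1) ℓ p.2 :=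
  PolyN.pieceLabel hΓ hL (PolyN.splitWeight hΓ hL ℓ hF) ℓ hF

/-- The number of steps does not depend on the input, so each step can be composed with the previous
program and the polynomials may grow with ℓ. -/
theorem PolyN.splitIter (hΓ : PolyGraph e Γ)
    (hF : PolyE (fun J : MultiwayInstance (c + 2) => J.enc) fun J => (F J).enc) (k ℓ : ℕ) :
    PolyN (ext e) (fun p => (splitIter F (Γ p.1) k ℓ).1 p.2) ∧
      PolyN e fun x => (splitIter F (Γ x) k ℓ).2 := by
  induction ℓ with
  | zero => exact ⟨.const 0, .const 1⟩
  | succ ℓ ih =>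
    obtain ⟨h1, h2⟩ := ih
    have hbig : PolyP e fun x => c * (Γ x).n <
        MinMaxCut.partSize (Γ x).n (MinMaxCut.splitIter F (Γ x) k ℓ).1 ℓ * k :=
      .lt ((PolyN.const c).mul hΓ.n)
        ((PolyN.partSize (L := fun x => (MinMaxCut.splitIter F (Γ x) k ℓ).1) hΓ.n hΓ.bdd h1 (.const ℓ)).mul (.const k))
    exact ⟨.ite (.and hbig.weaken (.eq h1 (.const ℓ)))
      (h2.weaken.add (PolyN.splitLabel (L := fun x => (MinMaxCut.splitIter F (Γ x) k ℓ).1) hΓ h1 ℓ hF)) h1,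
      .ite hbig (h2.add (.const _)) h2⟩

end

/-! ## Partition instances with natural weights -/

section

variable {k : ℕ} (I : PartitionInstance k)

/-- The numerator of an edge weight. -/
def PartitionInstance.num (i j : ℕ) : ℕ :=
  if h : i < I.n ∧ j < I.n then (I.graph.weight ⟨i, h.1⟩ ⟨j, h.2⟩).num else 0

/-- The denominator of an edge weight. -/
def PartitionInstance.den (i j : ℕ) : ℕ :=
  if h : i < I.n ∧ j < I.n then (I.graph.weight ⟨i, h.1⟩ ⟨j, h.2⟩).den else 0

/-- A common denominator of all edge weights. -/
def PartitionInstance.commonDen : ℕ :=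
  ∏ i ∈ Finset.range I.n, ∏ j ∈ Finset.range I.n, I.den i j

/-- The graph of the instance with its weights multiplied by `M * I.commonDen`. -/
def PartitionInstance.natGraph (M : ℕ) : NatGraph where
  n := I.n
  W i j := M * (I.num i j * (I.commonDen / I.den i j))
  symm i j := by
    simp only [PartitionInstance.num, PartitionInstance.den, I.graph.symm ⟨i, _⟩ ⟨j, _⟩, and_comm]
  loopless i := by
    simp [PartitionInstance.num, I.graph.loopless]

theorem PartitionInstance.natGraph_weight (M : ℕ) (i j : Fin I.n) :
    ((I.natGraph M).W i j : ℚ≥0) = M * I.commonDen * I.graph.weight i j := by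
  have h1 : I.den i j = (I.graph.weight i j).den := by simp [PartitionInstance.den]
  have h2 : I.num i j = (I.graph.weight i j).num := by simp [PartitionInstance.num]
  have h3 : I.den i j ∣ I.commonDen :=
    (Finset.dvd_prod_of_mem (fun j => I.den i j) (Finset.mem_range.2 j.2)).trans
      (Finset.dvd_prod_of_mem (fun i => ∏ j ∈ Finset.range I.n, I.den i j) (Finset.mem_range.2 i.2))
  have h4 : (I.den i j : ℚ≥0) ≠ 0 := by rw [h1]; simp
  simp only [PartitionInstance.natGraph]
  push_cast
  rw [Nat.cast_div h3 h4, h2, mul_assoc]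
  congr 1
  nth_rw 2 [← NNRat.num_div_den (I.graph.weight i j)]
  rw [h1]
  ring

theorem PartitionInstance.commonDen_pos : 0 < I.commonDen :=
  Finset.prod_pos fun i hi => Finset.prod_pos fun j hj => by
    simp only [PartitionInstance.den, Finset.mem_range.1 hi, Finset.mem_range.1 hj, and_self, dif_pos]
    exact NNRat.den_pos _

theorem PartitionInstance.doubleCut_natGraph (M : ℕ) (Q : Labelling I.n k) (q : ℕ → ℕ)
    (hq : ∀ v : Fin I.n, (Q v : ℕ) = q v) :
    (doubleCut I.n (I.natGraph M).W q : ℚ≥0) = 2 * (M * I.commonDen) * I.graph.cutWeight Q := by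
  have h1 : doubleCut I.n (I.natGraph M).W q =
      ∑ u : Fin I.n, ∑ v : Fin I.n, if Q u ≠ Q v then (I.natGraph M).W u v else 0 := by
    unfold doubleCut
    rw [← Fin.sum_univ_eq_sum_range
      (fun u => ∑ v ∈ Finset.range I.n, if q u ≠ q v then (I.natGraph M).W u v else 0)]
    refine Finset.sum_congr rfl fun u _ => ?_
    rw [← Fin.sum_univ_eq_sum_range (fun v => if q u ≠ q v then (I.natGraph M).W u v else 0)]
    refine Finset.sum_congr rfl fun v _ => ?_
    simp only [← hq, ne_eq, Fin.ext_iff]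
  have h2 : I.graph.cutWeight Q = ∑ u, ∑ v, if v < u ∧ Q u ≠ Q v then I.graph.weight u v else 0 := by
    unfold WeightedGraph.cutWeight
    rw [Finset.sum_comm]
    refine Finset.sum_congr rfl fun u _ => Finset.sum_congr rfl fun v _ => ?_
    simp only [I.graph.symm v u, ne_comm (a := Q v)]
  have h3 : 2 * I.graph.cutWeight Q = ∑ u, ∑ v, if Q u ≠ Q v then I.graph.weight u v else 0 := by
    rw [two_mul]
    nth_rw 2 [h2]
    unfold WeightedGraph.cutWeight
    simp only [← Finset.sum_add_distrib]
    refine Finset.sum_congr rfl fun u _ => Finset.sum_congr rfl fun v _ => ?_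
    rcases lt_trichotomy u v with h | rfl | h
    · simp [h, h.not_gt]
    · simp
    · simp [h, h.not_gt]
  rw [h1, mul_comm 2, mul_assoc, h3]
  push_cast
  simp only [Finset.mul_sum]
  refine Finset.sum_congr rfl fun u _ => Finset.sum_congr rfl fun v _ => ?_
  split_ifs
  · rw [PartitionInstance.natGraph_weight]
  · simp

/-- Balance and termination of the splitting rest on some equipartition to compare with. Consecutive
blocks of length n/k provide one. -/
theorem exists_equalParts (M : ℕ) : ∃ q, (I.natGraph M).EqualParts k q := by
  obtain ⟨t, ht⟩ := I.dvd
  refine ⟨fun v => v / t, fun v hv => ?_, fun i => ?_⟩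
  · have hv' : v < k * t := ht ▸ hv
    exact Nat.div_lt_of_lt_mul (by rwa [mul_comm] at hv')
  · change k * partSize I.n _ i ≤ I.n
    rw [ht]
    refine Nat.mul_le_mul_left k ?_
    rcases Nat.eq_zero_or_pos t with rfl | h0
    · simp [partSize]
    unfold partSize
    rw [← Finset.card_filter]
    calc _ ≤ (Finset.Ico (i * t) ((i + 1) * t)).card := by
          refine Finset.card_le_card fun v hv => ?_
          have := (Finset.mem_filter.1 hv).2
          rw [Nat.div_eq_iff h0] at this
          rw [Finset.mem_Ico, add_mul]
          omega
      _ = t := by simp [add_mul]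

theorem partSize_eq_card {n : ℕ} (Q : Labelling n k) (q : ℕ → ℕ) (hq : ∀ v : Fin n, (Q v : ℕ) = q v)
    (i : Fin k) : partSize n q i = (Q.part i).card := by
  unfold partSize Labelling.part
  rw [Finset.card_filter, ← Fin.sum_univ_eq_sum_range (fun v => if q v = i then 1 else 0)]
  simp only [← hq, Fin.ext_iff]

theorem Labelling.Equal.equalParts (M : ℕ) {Q : Labelling I.n k} (hQ : Q.Equal) (q : ℕ → ℕ)
    (hq : ∀ v : Fin I.n, (Q v : ℕ) = q v) : (I.natGraph M).EqualParts k q := by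
  have hlt : ∀ v < I.n, q v < k := fun v hv => by
    rw [← hq ⟨v, hv⟩]; exact Fin.is_lt _
  refine ⟨hlt, fun i => ?_⟩
  change k * partSize I.n q i ≤ I.n
  by_cases hi : i < k
  · have h1 : ∑ j : Fin k, (Q.part j).card = I.n := by
      have := Finset.card_eq_sum_card_fiberwise (f := Q) (s := Finset.univ) (t := Finset.univ) (by simp)
      simpa [Labelling.part] using this.symm
    have h2 : ∑ j : Fin k, (Q.part j).card = k * (Q.part ⟨i, hi⟩).card := by
      rw [Finset.sum_congr rfl fun j _ => hQ j ⟨i, hi⟩]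
      simp
    rw [partSize_eq_card Q q hq ⟨i, hi⟩]
    omega
  · have : partSize I.n q i = 0 := Finset.sum_eq_zero fun v hv => by
      have := hlt v (Finset.mem_range.1 hv)
      rw [if_neg (by omega)]
    simp [this]

end

/-! ### Merging the parts into `k` bins -/

/-- Relabelling with a table of length `N`. -/
def relabel (N : ℕ) (g L : ℕ → ℕ) (v : ℕ) : ℕ := if L v < N then g (L v) else 0

/-- The first relabelling in a list of tables that makes all parts small enough. -/
def pickLabel (N c k n : ℕ) (L : ℕ → ℕ) : List (ℕ → ℕ) → ℕ → ℕ
  | [], _ => 0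
  | g :: l, v =>
    if ¬ ∃ j < k, (c + 1) * n < k * partSize n (relabel N g L) j then relabel N g L v
    else pickLabel N c k n L l v

theorem pickLabel_spec {N c k n : ℕ} {L : ℕ → ℕ} {l : List (ℕ → ℕ)}
    (hl : ∃ g ∈ l, ∀ j < k, k * partSize n (relabel N g L) j ≤ (c + 1) * n) :
    ∃ g ∈ l, pickLabel N c k n L l = relabel N g L ∧
      ∀ j < k, k * partSize n (relabel N g L) j ≤ (c + 1) * n := by
  induction l with
  | nil => simp at hl
  | cons g l ih =>
    by_cases hg : ∃ j < k, (c + 1) * n < k * partSize n (relabel N g L) j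
    · have hl' : ∃ g ∈ l, ∀ j < k, k * partSize n (relabel N g L) j ≤ (c + 1) * n := by
        obtain ⟨g', hg', h⟩ := hl
        rcases List.mem_cons.1 hg' with rfl | hg'
        · obtain ⟨j, hj, hj'⟩ := hg
          exact absurd (h j hj) (not_le.2 hj')
        · exact ⟨g', hg', h⟩
      obtain ⟨g', hg', h1, h2⟩ := ih hl'
      refine ⟨g', List.mem_cons_of_mem _ hg', ?_, h2⟩
      rw [← h1]
      funext v
      simp only [pickLabel, hg, not_true, if_false]
    · refine ⟨g, List.mem_cons_self, ?_, fun j hj => not_lt.1 fun h => hg ⟨j, hj, h⟩⟩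
      funext v
      simp only [pickLabel, hg, not_false_eq_true, if_true]

theorem doubleCut_comp_le (n : ℕ) (W : ℕ → ℕ → ℕ) (L L' : ℕ → ℕ) (h : ∀ u v, L u = L v → L' u = L' v) :
    doubleCut n W L' ≤ doubleCut n W L := by
  refine Finset.sum_le_sum fun u _ => Finset.sum_le_sum fun v _ => ?_
  by_cases h1 : L u = L v
  · simp [h1, h u v h1]
  · simp only [ne_eq, h1, not_false_eq_true, if_true]
    split_ifs <;> simp

/-- All tables of length `N` with entries below `k`. -/
noncomputable def allTables (N k : ℕ) : List (ℕ → ℕ) :=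
  (Finset.univ : Finset (Fin N → Fin k)).toList.map fun σ x => if h : x < N then (σ ⟨x, h⟩ : ℕ) else 0

theorem lt_of_mem_allTables {N k : ℕ} (hk : 0 < k) {g : ℕ → ℕ} (hg : g ∈ allTables N k) (x : ℕ) : g x < k := by
  simp only [allTables, List.mem_map] at hg
  obtain ⟨σ, -, rfl⟩ := hg
  simp only
  split_ifs
  · exact Fin.is_lt _
  · exact hk

theorem sum_partSize {N n : ℕ} {L : ℕ → ℕ} (hL : ∀ v < n, L v < N) :
    ∑ i ∈ Finset.range N, partSize n L i = n := by
  unfold partSize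
  rw [Finset.sum_comm]
  calc _ = ∑ v ∈ Finset.range n, 1 := Finset.sum_congr rfl fun v hv => by
        simp [hL v (Finset.mem_range.1 hv)]
    _ = n := by simp

/-- Greedy grouping exceeds the average load n/k by at most one part, that is by cn/k. Only
existence matters, since all tables are tried. -/
theorem exists_table {N c k n : ℕ} (hk : 0 < k) {L : ℕ → ℕ} (hL : ∀ v < n, L v < N)
    (hsmall : ∀ i < N, k * partSize n L i ≤ c * n) :
    ∃ g ∈ allTables N k, ∀ j < k, k * partSize n (relabel N g L) j ≤ (c + 1) * n := by
  obtain ⟨σ, hσ⟩ := exists_grouping (fun i : Fin N => k * partSize n L i) (c * n) k hk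
    (fun i => hsmall i i.2)
  refine ⟨_, List.mem_map.2 ⟨σ, by simp, rfl⟩, fun j hj => ?_⟩
  set g : ℕ → ℕ := fun x => if h : x < N then (σ ⟨x, h⟩ : ℕ) else 0 with hg
  have h1 : partSize n (relabel N g L) j = ∑ i : Fin N, if σ i = ⟨j, hj⟩ then partSize n L i else 0 := by
    have h2 : ∀ i : Fin N, (if σ i = ⟨j, hj⟩ then partSize n L i else 0) =
        (fun x : ℕ => if g x = j then partSize n L x else 0) i := fun i => by
      simp [hg, Fin.ext_iff]
    simp only [h2]
    rw [Fin.sum_univ_eq_sum_range (fun x : ℕ => if g x = j then partSize n L x else 0)]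
    simp only [partSize, ← Finset.sum_filter (p := fun x => g x = j)]
    rw [Finset.sum_comm]
    refine Finset.sum_congr rfl fun v hv => ?_
    have h3 := hL v (by simpa using hv)
    simp only [relabel, h3, if_true, Finset.sum_ite_eq, Finset.mem_filter, Finset.mem_range, true_and]
  have h2 := hσ ⟨j, hj⟩
  rw [← Finset.mul_sum, Fin.sum_univ_eq_sum_range (fun x : ℕ => partSize n L x), sum_partSize hL] at h2
  have h4 : (∑ i : Fin N, if σ i = ⟨j, hj⟩ then k * partSize n L i else 0) =
      k * partSize n (relabel N g L) j := by
    rw [h1, Finset.mul_sum]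
    exact Finset.sum_congr rfl fun i _ => by split_ifs <;> simp
  rw [h4] at h2
  refine Nat.le_of_mul_le_mul_left (h2.trans (le_of_eq ?_)) hk
  ring

/-! ### Polynomial time for merging and for reading partition instances -/

section

variable {X : Type} {e : X → Value}

/-- The list of tables is fixed independently of the input, so exhaustive search is a fixed cascade
of branches. -/
theorem PolyN.pickLabel {n : X → ℕ} (hn : PolyN e n) (hnb : PolyBdd e n) {L : X → ℕ → ℕ}
    (hL : PolyN (ext e) fun p => L p.1 p.2) (N c k : ℕ) (l : List (ℕ → ℕ)) :
    PolyN (ext e) fun p => pickLabel N c k (n p.1) (L p.1) l p.2 := by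
  induction l with
  | nil => exact .const 0
  | cons g l ih =>
    have h1 : PolyN (ext e) fun p => relabel N g (L p.1) p.2 := hL.table g N
    refine .ite (PolyP.weaken (P := fun x => ¬ ∃ j < k, (c + 1) * n x <
      k * MinMaxCut.partSize (n x) (relabel N g (L x)) j) (PolyP.not ?_)) h1 ih
    refine PolyP.exists_lt (n := fun _ => k) (.const k) (.const k) (.lt (.mul (.const _) hn.weaken) (.mul (.const k) ?_))
    exact PolyN.partSize (L := fun p => relabel N g (L p.1)) hn.weaken hnb.weaken
      (PolyN.weakenFun (L := fun x => relabel N g (L x)) h1) PolyN.var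

variable (k : ℕ)

theorem PolyN.partition_n : PolyN (fun I : PartitionInstance k => I.enc) fun I => I.n := by
  have := PolyE.length (e := fun I : PartitionInstance k => I.enc) (l := fun I => List.ofFn fun u =>
    encSeq fun v => encRat (I.graph.weight u v)) PolyE.id
  simpa using this

theorem PolyBdd.partition_n : PolyBdd (fun I : PartitionInstance k => I.enc) fun I => I.n :=
  PolyBdd.size.mono fun I => by
    have := length_le_size (List.ofFn fun u => encSeq fun v => encRat (I.graph.weight u v))
    rwa [List.length_ofFn] at this

theorem PolyE.partition_entry :
    PolyE (ext (ext fun I : PartitionInstance k => I.enc)) fun p =>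
      if h : p.1.2 < p.1.1.n ∧ p.2 < p.1.1.n then
        encRat (p.1.1.graph.weight ⟨p.1.2, h.1⟩ ⟨p.2, h.2⟩) else .num 0 := by
  let row : PartitionInstance k → ℕ → List Value := fun I i =>
    if h : i < I.n then List.ofFn fun v => encRat (I.graph.weight ⟨i, h⟩ v) else []
  have h1 : PolyE (ext fun I : PartitionInstance k => I.enc) fun p => encList (row p.1 p.2) := by
    have := PolyE.getD (e := ext fun I : PartitionInstance k => I.enc)
      (l := fun p => List.ofFn fun u => encSeq fun v => encRat (p.1.graph.weight u v))
      PolyE.weaken₁ PolyN.var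
    convert this using 2 with p
    by_cases h : p.2 < p.1.n
    · rw [List.getD_eq_getElem _ _ (by simpa using h)]
      simp [row, h, encSeq]
    · rw [List.getD_eq_default _ _ (by simpa using h)]
      simp [row, h, encList]
  have h2 := PolyE.getD h1.weaken PolyN.var
  convert h2 using 2 with p
  by_cases h : p.1.2 < p.1.1.n
  · by_cases h' : p.2 < p.1.1.n
    · simp [row, h, h']
    · simp [row, h, h']
  · simp [row, h]

theorem PolyN.partition_num : PolyN (ext (ext fun I : PartitionInstance k => I.enc))
    fun p => p.1.1.num p.1.2 p.2 := by
  have := (PolyE.partition_entry k).app .fst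
  unfold PolyN
  convert this using 2 with p
  simp only [PartitionInstance.num]
  split_ifs <;> rfl

theorem PolyN.partition_den : PolyN (ext (ext fun I : PartitionInstance k => I.enc))
    fun p => p.1.1.den p.1.2 p.2 := by
  have := (PolyE.partition_entry k).app .snd
  unfold PolyN
  convert this using 2 with p
  simp only [PartitionInstance.den]
  split_ifs <;> rfl

theorem PolyN.partition_commonDen :
    PolyN (fun I : PartitionInstance k => I.enc) fun I => I.commonDen :=
  PolyN.prod (.partition_n k) (.partition_n k)
    (F := fun I i => ∏ j ∈ Finset.range I.n, I.den i j)
    (PolyN.prod (n := fun p : PartitionInstance k × ℕ => p.1.n) (PolyN.partition_n k).weaken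
      (PolyBdd.partition_n k).weaken (F := fun p j => p.1.den p.2 j) (.partition_den k))

theorem polyGraph_partition (a : ℕ) : PolyGraph (fun I : PartitionInstance k => I.enc)
    fun I => I.natGraph (a * (I.n + 1)) where
  n := .partition_n k
  bdd := .partition_n k
  W := .mul (.mul (.const a) ((PolyN.partition_n k).weaken.weaken.add (.const 1)))
    (.mul (.partition_num k) (.div (PolyN.partition_commonDen k).weaken.weaken (.partition_den k)))

end

/-! ## The reduction -/

/-- All vertices go into one part: nothing is cut, and n ≤ γn/k. -/
theorem hasPartitionBicriteria_of_le {k : ℕ} (hk : 0 < k) {α γ : ℝ} (hα : 0 ≤ α) (h : (k : ℝ) ≤ γ) :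
    HasPartitionBicriteria k α γ := by
  have hp : PolyE (fun I : PartitionInstance k => I.enc) fun I => encSeq fun _ : Fin I.n => .num 0 :=
    PolyE.tabulate (.partition_n k) (.partition_n k) (F := fun _ _ => .num 0) (.const 0)
  obtain ⟨p, q, hpq⟩ := hp
  refine ⟨p, q, fun I => ?_⟩
  obtain ⟨t, h1, h2⟩ := hpq I
  refine ⟨fun _ => ⟨0, hk⟩, t, h1, h2, fun i => ?_, fun Q _ => ?_⟩
  · have hk' : (0 : ℝ) < k := by exact_mod_cast hk
    rw [le_div_iff₀ hk', mul_comm]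
    have h3 : (((Labelling.part (fun _ : Fin I.n => (⟨0, hk⟩ : Fin k)) i).card : ℕ) : ℝ) ≤ I.n := by
      exact_mod_cast (Finset.card_le_univ _).trans (by simp)
    exact mul_le_mul h h3 (by positivity) (hk'.le.trans h)
  · simp only [WeightedGraph.cutWeight, ne_eq, not_true, and_false, if_false, Finset.sum_const_zero]
    simp only [NNRat.cast_zero]
    positivity

theorem hasPartitionBicriteria_of_oracle {c k : ℕ} (hc : 8 ≤ c) (hk : c + 2 ≤ k)
    {F : (J : MultiwayInstance (c + 2)) → Labelling J.n (c + 2)} (hF : IsMultiwayOracle c F)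
    (hFp : PolyE (fun J : MultiwayInstance (c + 2) => J.enc) fun J => (F J).enc) :
    HasPartitionBicriteria k ((k : ℝ) ^ 2) ((c + 1 : ℕ) : ℝ) := by
  have hk0 : 0 < k := by omega
  set N := 1 + (c + 2) * (2 * k) with hN
  -- The summand 1 makes `M` positive and strictly larger than (c + 2)²n, as `splitLabel_cut`
  -- requires.
  let M : PartitionInstance k → ℕ := fun I => (c + 2) * (c + 2) * (I.n + 1)
  let L : PartitionInstance k → ℕ → ℕ := fun I => (splitIter F (I.natGraph (M I)) k N).1
  let out : PartitionInstance k → ℕ → ℕ := fun I => pickLabel N c k I.n (L I) (allTables N k)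
  have hΓ : PolyGraph (fun I : PartitionInstance k => I.enc) fun I => I.natGraph (M I) :=
    polyGraph_partition k _
  have hp : PolyE (fun I : PartitionInstance k => I.enc) fun I => encSeq fun v : Fin I.n => .num (out I v) :=
    PolyE.tabulate (.partition_n k) (.partition_n k) (F := fun I v => .num (out I v))
      (PolyN.pickLabel (.partition_n k) (.partition_n k) (L := L) (PolyN.splitIter hΓ hFp k N).1 N c k _)
  obtain ⟨p, r, hpr⟩ := hp
  refine ⟨p, r, fun I => ?_⟩
  obtain ⟨t, ht1, ht2⟩ := hpr I
  have hM : ∀ u v, M I ∣ (I.natGraph (M I)).W u v := fun u v => Dvd.intro _ rfl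
  have hM0 : 0 < M I := by positivity
  obtain ⟨h1, h2, h3⟩ := splitIter_spec (F := F) (Γ := I.natGraph (M I)) hc hF hM
    (by simp only [M, PartitionInstance.natGraph]; gcongr; omega) hk (exists_equalParts I _) hN
  obtain ⟨g, hg, h4, h5⟩ := pickLabel_spec (exists_table hk0 h1 h2)
  have hout : out I = relabel N g (L I) := h4
  have hlt : ∀ v, out I v < k := fun v => by
    rw [hout, relabel]
    split_ifs
    · exact lt_of_mem_allTables hk0 hg _
    · exact hk0
  let P : Labelling I.n k := fun v => ⟨out I v, hlt v⟩
  refine ⟨P, t, ht1, ht2, fun i => ?_, fun Q hQ => ?_⟩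
  · have h6 := h5 i i.2
    change k * partSize I.n (relabel N g (L I)) i ≤ (c + 1) * I.n at h6
    rw [← hout, partSize_eq_card P (out I) (fun v => rfl)] at h6
    rw [le_div_iff₀ (by exact_mod_cast hk0), mul_comm]
    exact_mod_cast h6
  · let q : ℕ → ℕ := fun v => if h : v < I.n then (Q ⟨v, h⟩ : ℕ) else 0
    have hq : ∀ v : Fin I.n, (Q v : ℕ) = q v := fun v => by simp [q]
    have h6 := h3 q (Labelling.Equal.equalParts I (M I) hQ q hq)
    have h7 : doubleCut I.n (I.natGraph (M I)).W (out I) ≤ k ^ 2 * doubleCut I.n (I.natGraph (M I)).W q :=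
      (doubleCut_comp_le _ _ (L I) _ fun u v h => by simp only [hout, relabel, h]).trans h6
    have h8 : (doubleCut I.n (I.natGraph (M I)).W (out I) : ℚ≥0) ≤
        k ^ 2 * doubleCut I.n (I.natGraph (M I)).W q := by exact_mod_cast h7
    rw [I.doubleCut_natGraph _ P (out I) (fun v => rfl), I.doubleCut_natGraph _ Q q hq] at h8
    have h9 : I.graph.cutWeight P ≤ k ^ 2 * I.graph.cutWeight Q := by
      have h10 : (0 : ℚ≥0) < 2 * (M I * I.commonDen) := by
        have := I.commonDen_pos
        positivity
      refine le_of_mul_le_mul_left (h8.trans (le_of_eq ?_)) h10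
      ring
    exact_mod_cast h9

/-- On a single edge between two terminals every solution has positive value, and the output
competes with itself. -/
theorem one_le_of_hasMultiwayApprox_two {ρ : ℝ} (h : HasMultiwayApprox 2 ρ) : 1 ≤ ρ := by
  obtain ⟨p, q, h⟩ := h
  let I : MultiwayInstance 2 :=
    { n := 2
      graph :=
        { weight := fun u v => if u = v then 0 else 1
          symm := fun u v => by simp only [eq_comm]
          loopless := fun v => by simp }
      terminal := Function.Embedding.refl _ }
  obtain ⟨P, t, -, -, hP, hQ⟩ := h I
  have h1 := hQ P hP
  have h2 : 0 < I.graph.maxBoundary P := by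
    have h3 : I.graph.boundary (P.part 0) ≤ I.graph.maxBoundary P :=
      Finset.le_sup (f := fun i => I.graph.boundary (P.part i)) (Finset.mem_univ _)
    refine lt_of_lt_of_le ?_ h3
    obtain ⟨u, hu, -⟩ := hP 0
    obtain ⟨v, hv, -⟩ := hP 1
    have hu' : P u = 0 := by simpa [I, Labelling.part] using hu
    have hv' : P v = 1 := by simpa [I, Labelling.part] using hv
    have huv : u ≠ v := fun h => by subst h; simp [hu'] at hv'
    have h4 : I.graph.weight u v = 1 := if_neg huv
    rw [WeightedGraph.boundary_part]
    refine Finset.sum_pos' (fun _ _ => zero_le) ⟨u, Finset.mem_univ _, ?_⟩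
    rw [if_pos hu']
    refine Finset.sum_pos' (fun _ _ => zero_le) ⟨v, Finset.mem_univ _, ?_⟩
    rw [if_pos (by simp [hv']), h4]
    exact one_pos
  have h3 : (0 : ℝ) < (I.graph.maxBoundary P : ℝ) := by exact_mod_cast h2
  nlinarith

/-- Turns the program into a function `F`, so that the splitting procedure can be defined and
analysed without reference to runs. -/
theorem exists_oracle {c : ℕ} {ρ : ℝ} (h : HasMultiwayApprox (c + 2) ρ) (hρ : 9 * ρ ≤ (c + 2 : ℕ)) :
    ∃ F : (J : MultiwayInstance (c + 2)) → Labelling J.n (c + 2), IsMultiwayOracle c F ∧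
      PolyE (fun J : MultiwayInstance (c + 2) => J.enc) fun J => (F J).enc := by
  obtain ⟨p, q, h⟩ := h
  choose F t h1 h2 h3 using h
  refine ⟨F, fun J => ⟨(h3 J).1, fun Q hQ => ?_⟩, p, q, fun J => ⟨t J, h1 J, h2 J⟩⟩
  have h4 := (h3 J).2 Q hQ
  have h5 : (0 : ℝ) ≤ (J.graph.maxBoundary Q : ℝ) := NNRat.cast_nonneg _
  have h6 : (9 : ℝ) * (J.graph.maxBoundary (F J) : ℝ) ≤ (c + 2 : ℕ) * (J.graph.maxBoundary Q : ℝ) := by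
    nlinarith
  exact_mod_cast h6

end MinMaxCut

theorem mainTheorem6 (ε : ℝ) (hε : 0 < ε)
    (h : ∀ k : ℕ, 2 ≤ k → MinMaxCut.HasMultiwayApprox k ((k : ℝ) ^ (1 - ε))) :
    ∃ γ : ℝ, γ ≤ (3 : ℝ) ^ (2 / ε) ∧
      ∀ k : ℕ, 2 ≤ k → MinMaxCut.HasPartitionBicriteria k ((k : ℝ) ^ 2) γ := by
  -- For ε > 1 the assumed ratio 2^(1 − ε) would be below 1.
  have hε1 : ε ≤ 1 := by
    by_contra! hlt
    have h1 := MinMaxCut.one_le_of_hasMultiwayApprox_two (h 2 le_rfl)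
    have h2 : ((2 : ℕ) : ℝ) ^ (1 - ε) < 1 := Real.rpow_lt_one_of_one_lt_of_neg (by norm_num) (by linarith)
    linarith
  set A : ℝ := (3 : ℝ) ^ (2 / ε) with hA
  have hA9 : 9 ≤ A := by
    calc (9 : ℝ) = 3 ^ (2 : ℝ) := by norm_num
      _ ≤ A := Real.rpow_le_rpow_of_exponent_le (by norm_num) (by rw [le_div_iff₀ hε]; linarith)
  -- Rounding down keeps γ = c + 1 at most A, while the number c + 2 of terminals exceeds A.
  obtain ⟨c, hc⟩ : ∃ c, ⌊A⌋₊ = c + 1 := Nat.exists_eq_succ_of_ne_zero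
    (Nat.pos_iff_ne_zero.1 (Nat.floor_pos.2 (by linarith)))
  have hc8 : 8 ≤ c := by
    have : 9 ≤ ⌊A⌋₊ := Nat.le_floor (by exact_mod_cast hA9)
    omega
  refine ⟨((c + 1 : ℕ) : ℝ), by rw [← hc]; exact Nat.floor_le (by linarith), fun k hk => ?_⟩
  rcases le_or_gt k (c + 1) with hkc | hkc
  · exact MinMaxCut.hasPartitionBicriteria_of_le (by omega) (by positivity) (by exact_mod_cast hkc)
  have hpow : (9 : ℝ) ≤ ((c + 2 : ℕ) : ℝ) ^ ε := by
    have h1 : A ≤ ((c + 2 : ℕ) : ℝ) := by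
      have := Nat.lt_floor_add_one A
      rw [hc] at this
      push_cast at this ⊢
      linarith
    calc (9 : ℝ) = A ^ ε := by
          rw [hA, ← Real.rpow_mul (by norm_num), div_mul_cancel₀ _ hε.ne']; norm_num
      _ ≤ _ := Real.rpow_le_rpow (by linarith) h1 hε.le
  have hρ : 9 * ((c + 2 : ℕ) : ℝ) ^ (1 - ε) ≤ ((c + 2 : ℕ) : ℝ) := by
    have h0 : (0 : ℝ) < ((c + 2 : ℕ) : ℝ) := by positivity
    rw [Real.rpow_sub h0, Real.rpow_one, mul_div_assoc', div_le_iff₀ (by positivity), mul_comm]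
    gcongr
  obtain ⟨F, hF, hFp⟩ := MinMaxCut.exists_oracle (h (c + 2) (by omega)) hρ
  exact MinMaxCut.hasPartitionBicriteria_of_oracle hc8 (by omega) hF hFp
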